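/- **Setting.** A server stores objects $1,\dots,N$; a cache stores $h$ of them, $1\le h\le N$; every request is answered with $k$ objects, $1\le k\le N$. Serving object $o$ to request $r\in\mathcal R$ costs $c_d(r,o)\ge 0$ from the cache and $c_d(r,o)+c_f$ from the server, where $c_f>0$. Let $c(r,i)=c_d(r,i)$ and $c(r,i+N)=c_d(r,i)+c_f$ for $i\le N$, and let $\pi^r$ be a permutation of $\{1,\dots,2N\}$ that sorts $c(r,\cdot)$ in increasing order. A cache state is a vector $x\in\{0,1\}^{2N}$ with $x_{i+N}=1-x_i$; the valid states are $\mathcal X=\{x:\ \sum_{i\le N}x_i=h\}$. Put $$C(r,x)=\sum_{i=1}^{2N}c(r,\pi^r_i)\,x_{\pi^r_i}\,\mathbf 1\Big\{\sum_{j<i}x_{\pi^r_j}<k\Big\},\qquad G(r,x)=C\big(r,(0,\dots,0,1,\dots,1)\big)-C(r,x).$$ The gain is extended to fractional states $y$ (also with $y_{i+N}=1-y_i$) by the concave function $G(r,y)=\sum_{i=1}^{K^r-1}\alpha^r_i\min\{k-\sigma^r_i,\ \sum_{j\le i}y_{\pi^r_j}-\sigma^r_i\}$ of $(y_1,\dots,y_N)$,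 where $\sigma^r_i=\#\{j\le i:\pi^r_j>N\}$, $K^r=\min\{i:\sigma^r_i=k\}$ and $\alpha^r_i=c(r,\pi^r_{i+1})-c(r,\pi^r_i)$. Let $c_d^k$ be an upper bound, over all $r\in\mathcal R$, on the $k$-th smallest of the numbers $c_d(r,1),\dots,c_d(r,N)$. **Algorithm.** Let $\Phi(y)=\sum_{i\le N}y_i\log y_i$, $\mathcal D=\mathbb R_{>0}^N$, and let $\mathcal Y\subset\mathbb R^N$ be the set of first halves of the elements of $\mathrm{conv}(\mathcal X)$. Start from $y_1=\arg\min_{\mathcal Y\cap\mathcal D}\Phi$. After request $r_t$, let $z_{t+1}=(\nabla\Phi)^{-1}(\nabla\Phi(y_t)+\eta g_t)$, where $g_t$ is a subgradient at $y_t$ of the concave function $G(r_t,\cdot)$ on $\mathbb R^N$ (for instance the one with components $g_{t,l}=c(r_t,\pi^{r_t}_{i_*+1})-c(r_t,l)$ if $(\pi^{r_t})^{-1}(l)\le i_*$ and $g_{t,l}=0$ otherwise, where $i_*=i_*(l)$ is the largest $i\le K^{r_t}-1$ with $\sum_{j\le i}y_{t,\pi^{r_t}_j}\le k$ and $l+N\notin\{\pi^{r_t}_1,\dots,\pi^{r_t}_i\}$),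 and let $y_{t+1}$ be the Bregman projection of $z_{t+1}$ onto $\mathcal Y\cap\mathcal D$. The integral states are drawn by one of two schemes. * *DepRound with freezing period 1*: each $x_t$ is a fresh dependent rounding of $y_t$. That is, as long as two coordinates $v_i,v_j$ are in $(0,1)$, with $\delta_1=\min(1-v_i,v_j)$ and $\delta_2=\min(v_i,1-v_j)$, replace $(v_i,v_j)$ by $(v_i+\delta_1,v_j-\delta_1)$ with probability $\frac{\delta_2}{\delta_1+\delta_2}$ and by $(v_i-\delta_2,v_j+\delta_2)$ otherwise. * *Coupled Rounding*: $x_1$ is drawn from $y_1$ by DepRound or by $N$ independent coin tosses with success probabilities $y_{1,i}$. Given $x_t$, independently for each $i\le N$ and with $\delta_i=y_{t+1,i}-y_{t,i}$: if $x_{t,i}=1$ and $\delta_i<0$, then $x_{t+1,i}=1$ with probability $(y_{t,i}+\delta_i)/y_{t,i}$; if $x_{t,i}=0$ and $\delta_i>0$, then $x_{t+1,i}=1$ with probability $\delta_i/(1-y_{t,i})$; otherwise $x_{t+1,i}=x_{t,i}$. **Theorem.** With learning rate $\eta=\frac{1}{c_d^k+c_f}\sqrt{\frac{2\log(N/h)}{T}}$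 and either rounding scheme, for every horizon $T\ge 1$, $$\sup_{(r_1,\dots,r_T)\in\mathcal R^T}\Big\{\Big(1-\frac1e\Big)\max_{x\in\mathcal X}\sum_{t=1}^T G(r_t,x)-\mathbb E\Big[\sum_{t=1}^T G(r_t,x_t)\Big]\Big\}\ \le\ \Big(1-\frac1e\Big)(c_d^k+c_f)\,h\,\sqrt{2\log(N/h)\,T}.$$ In particular the $(1-1/e)$-regret is sublinear in $T$: for every $\varepsilon>0$ it is at most $\varepsilon T$ for all sufficiently large $T$. -/

import Mathlib

/-- A similarity-cache system with catalog `{1, …, N}` (indexed by `Fin N`), cache capacity `h`,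
answers made of `k` objects, dissimilarity costs `cd r o ≥ 0`, retrieval cost `cf > 0`.

The augmented catalog of `2N` elements is `Fin N ⊕ Fin N`: `Sum.inl i` is object `i` served from
the cache and `Sum.inr i` (the index `i + N`) is the same object served from the remote server.
`order r i`, for `1 ≤ i ≤ 2N`, is the `i`-th closest element of the augmented catalog to the
request `r`, ties being broken in an arbitrary way. -/
structure SimilarityCache (R : Type*) where
  N : ℕ
  h : ℕ
  k : ℕ
  one_le_h : 1 ≤ h
  h_le_N : h ≤ N
  one_le_k : 1 ≤ k
  k_le_N : k ≤ N
  cd : R → Fin N → ℝ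
  cd_nonneg : ∀ r o, 0 ≤ cd r o
  cf : ℝ
  cf_pos : 0 < cf
  order : R → ℕ → Fin N ⊕ Fin N
  order_bijOn : ∀ r, Set.BijOn (order r) (Set.Icc 1 (2 * N)) Set.univ
  order_monotoneOn : ∀ r, MonotoneOn
    (fun i => Sum.elim (cd r) (fun o => cd r o + cf) (order r i)) (Set.Icc 1 (2 * N))

namespace SimilarityCache

variable {R : Type*} (m : SimilarityCache R)

/-! ### Costs and gains -/

/-- Cost of an element of the augmented catalog. -/
def cost (r : R) : Fin m.N ⊕ Fin m.N → ℝ :=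
  Sum.elim (m.cd r) (fun o => m.cd r o + m.cf)

/-- The dissimilarity cost of the `k`-th closest object of the catalog to `r`: the `k`-th entry of
the increasingly sorted list of the `N` dissimilarity costs. -/
noncomputable def kthDissimilarity (r : R) : ℝ :=
  m.cd r (Tuple.sort (m.cd r)
    ⟨m.k - 1, by have h₁ := m.one_le_k; have h₂ := m.k_le_N; omega⟩)

/-- Full vector of length `2N` with first half `y` and `y (i + N) = 1 - y i`. -/
def augment {n : ℕ} (y : Fin n → ℝ) : Fin n ⊕ Fin n → ℝ :=
  Sum.elim y (fun i => 1 - y i)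

/-- The set of valid cache states. -/
def states : Set (Fin m.N ⊕ Fin m.N → ℝ) :=
  {x | (∀ u, x u = 0 ∨ x u = 1) ∧ ∑ i, x (Sum.inl i) = (m.h : ℝ) ∧
    ∀ j, x (Sum.inr j) = 1 - x (Sum.inl j)}

/-- `x_{π_1} + ⋯ + x_{π_i}`. -/
def prefixSum (r : R) (x : Fin m.N ⊕ Fin m.N → ℝ) (i : ℕ) : ℝ :=
  ∑ j ∈ Finset.Icc 1 i, x (m.order r j)

open Classical in
/-- Total cost to serve the request `r` in the state `x`: the first `k` elements `u` of the order
with `x u = 1` are served. -/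
noncomputable def serviceCost (r : R) (x : Fin m.N ⊕ Fin m.N → ℝ) : ℝ :=
  ∑ i ∈ Finset.Icc 1 (2 * m.N), m.cost r (m.order r i) * x (m.order r i) *
    (if m.prefixSum r x (i - 1) < (m.k : ℝ) then 1 else 0)

/-- Caching gain: the cost with an empty cache minus the cost in the state `x`. -/
noncomputable def gain (r : R) (x : Fin m.N ⊕ Fin m.N → ℝ) : ℝ :=
  m.serviceCost r (Sum.elim (fun _ => 0) (fun _ => 1)) - m.serviceCost r x

/-- `σ_i`: the number of server elements among the `i` closest ones. -/
def sigma (r : R) (i : ℕ) : ℕ :=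
  ((Finset.Icc 1 i).filter (fun j => (m.order r j).isRight = true)).card

/-- `K`: the least index `i` with `σ_i = k`. -/
noncomputable def bigK (r : R) : ℕ := sInf {i | m.sigma r i = m.k}

/-- `α_i`: difference between the `(i+1)`-th smallest and the `i`-th smallest cost. -/
def alpha (r : R) (i : ℕ) : ℝ := m.cost r (m.order r (i + 1)) - m.cost r (m.order r i)

/-- The concave extension of the gain to fractional states, as a function of the first `N`
coordinates. -/
noncomputable def fracGain (r : R) (y : Fin m.N → ℝ) : ℝ :=
  ∑ i ∈ Finset.Ico 1 (m.bigK r), m.alpha r i *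
    min ((m.k : ℝ) - m.sigma r i) (m.prefixSum r (augment y) i - m.sigma r i)

/-- `g` is a subgradient (in the sense of concave functions) of the fractional gain at `y`. -/
def IsSubgradient (r : R) (y g : Fin m.N → ℝ) : Prop :=
  ∀ y' : Fin m.N → ℝ, m.fracGain r y' ≤ m.fracGain r y + ∑ i, g i * (y' i - y i)

/-- The position of the local copy of object `l` in the order. -/
noncomputable def rank (r : R) (l : Fin m.N) : ℕ :=
  sInf {i | i ∈ Set.Icc 1 (2 * m.N) ∧ m.order r i = Sum.inl l}

/-- The largest `i ≤ K - 1` with `y_{π_1} + ⋯ + y_{π_i} ≤ k` and with the server copy of `l` not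
among the first `i` elements. -/
noncomputable def lastActive (r : R) (y : Fin m.N → ℝ) (l : Fin m.N) : ℕ :=
  sSup {i | i ∈ Set.Icc 1 (m.bigK r - 1) ∧ m.prefixSum r (augment y) i ≤ (m.k : ℝ) ∧
    ∀ v ∈ Set.Icc 1 i, m.order r v ≠ Sum.inr l}

/-- The closed-form ascent direction (a particular subgradient). -/
noncomputable def explicitSubgradient (r : R) (y : Fin m.N → ℝ) : Fin m.N → ℝ := fun l =>
  if m.rank r l ≤ m.lastActive r y l then
    m.cost r (m.order r (m.lastActive r y l + 1)) - m.cost r (Sum.inl l)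
  else 0

/-! ### Online mirror ascent -/

/-- Fractional states: the convex hull of the valid states, in the first `N` coordinates. -/
def fracStates : Set (Fin m.N → ℝ) := {y | augment y ∈ convexHull ℝ m.states}

/-- Gradient (vector of partial derivatives). -/
noncomputable def grad {n : ℕ} (Φ : (Fin n → ℝ) → ℝ) (y : Fin n → ℝ) : Fin n → ℝ :=
  fun i => fderiv ℝ Φ y (Pi.single i 1)

/-- Bregman divergence. -/
noncomputable def bregman {n : ℕ} (Φ : (Fin n → ℝ) → ℝ) (y z : Fin n → ℝ) : ℝ :=
  Φ y - Φ z - ∑ i, grad Φ z i * (y i - z i)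

/-- A minimizer of `f` on `S` (an arbitrary vector if there is none). -/
noncomputable def argminOn {n : ℕ} (S : Set (Fin n → ℝ)) (f : (Fin n → ℝ) → ℝ) : Fin n → ℝ :=
  Classical.epsilon fun y => y ∈ S ∧ IsMinOn f S y

/-- One step of mirror ascent from `y` in the direction `g`: gradient step of size `η` in the dual,
back to the primal, Bregman projection onto `Y ∩ D`. -/
noncomputable def mirrorStep {n : ℕ} (Φ : (Fin n → ℝ) → ℝ) (D Y : Set (Fin n → ℝ)) (η : ℝ)
    (y g : Fin n → ℝ) : Fin n → ℝ :=
  argminOn (Y ∩ D) fun y' =>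
    bregman Φ y' (Function.invFunOn (grad Φ) D (grad Φ y + η • g))

/-- The fractional states selected by online mirror ascent. Time starts at `0`: `oma … t` is the
state used for the request `r t`. -/
noncomputable def oma (Φ : (Fin m.N → ℝ) → ℝ) (D : Set (Fin m.N → ℝ)) (η : ℝ)
    (sub : R → (Fin m.N → ℝ) → Fin m.N → ℝ) (r : ℕ → R) : ℕ → Fin m.N → ℝ
  | 0 => argminOn (m.fracStates ∩ D) Φ
  | t + 1 => mirrorStep Φ D m.fracStates η (oma Φ D η sub r t)
      (sub (r t) (oma Φ D η sub r t))

/-- Negative entropy. -/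
noncomputable def negEntropy {n : ℕ} (y : Fin n → ℝ) : ℝ := ∑ i, y i * Real.log (y i)

/-- Domain of the negative entropy mirror map. -/
def posOrthant (n : ℕ) : Set (Fin n → ℝ) := {y | ∀ i, 0 < y i}

/-! ### Rounding

An integral state is `s : Fin N → Bool`, with `s i = true` iff object `i` is stored. -/

/-- The first `N` coordinates of the state. -/
def bits {n : ℕ} (s : Fin n → Bool) : Fin n → ℝ := fun i => if s i = true then 1 else 0

/-- `i` and `j` are two distinct coordinates of `v` that are not rounded yet. -/
def Unrounded {n : ℕ} (v : Fin n → ℝ) (i j : Fin n) : Prop :=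
  i ≠ j ∧ v i ∈ Set.Ioo (0 : ℝ) 1 ∧ v j ∈ Set.Ioo (0 : ℝ) 1

/-- `pick` selects two unrounded coordinates whenever there are two. -/
def IsPairRule {n : ℕ} (pick : (Fin n → ℝ) → Fin n × Fin n) : Prop :=
  ∀ v, (∃ i j, Unrounded v i j) → Unrounded v (pick v).1 (pick v).2

/-- The vector `v` with mass `a` moved from coordinate `j` to coordinate `i`. -/
def shift {n : ℕ} (v : Fin n → ℝ) (i j : Fin n) (a : ℝ) : Fin n → ℝ :=
  v + Pi.single i a - Pi.single j a

open Classical in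
/-- `depRoundAux pick n v s` is the probability that dependent rounding, run for at most `n`
iterations from `v`, returns `s`. An iteration takes two unrounded coordinates `i, j` and, with
`δ₁ = min (1 - v i) (v j)` and `δ₂ = min (v i) (1 - v j)`, moves mass `δ₁` from `j` to `i` with
probability `δ₂ / (δ₁ + δ₂)`, and mass `δ₂` from `i` to `j` with probability `δ₁ / (δ₁ + δ₂)`;
at least one of the two coordinates becomes `0` or `1`. -/
noncomputable def depRoundAux {N : ℕ} (pick : (Fin N → ℝ) → Fin N × Fin N) :
    ℕ → (Fin N → ℝ) → (Fin N → Bool) → ℝ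
  | 0, v, s => if v = bits s then 1 else 0
  | n + 1, v, s =>
    if Unrounded v (pick v).1 (pick v).2 then
      let i := (pick v).1
      let j := (pick v).2
      let δ₁ := min (1 - v i) (v j)
      let δ₂ := min (v i) (1 - v j)
      δ₂ / (δ₁ + δ₂) * depRoundAux pick n (shift v i j δ₁) s +
        δ₁ / (δ₁ + δ₂) * depRoundAux pick n (shift v j i δ₂) s
    else if v = bits s then 1 else 0

/-- `depRound pick y s` is the probability that dependent rounding of `y` returns `s`. Every
iteration rounds a coordinate, so `N` iterations suffice. -/
noncomputable def depRound {N : ℕ} (pick : (Fin N → ℝ) → Fin N × Fin N)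
    (y : Fin N → ℝ) (s : Fin N → Bool) : ℝ :=
  depRoundAux pick N y s

/-- The probability that `N` independent coin tosses, with success probabilities `y i`, give `s`. -/
def coinTosses {N : ℕ} (y : Fin N → ℝ) (s : Fin N → Bool) : ℝ :=
  ∏ i, if s i = true then y i else 1 - y i

open Classical in
/-- Coupled rounding of one coordinate: the probability that the next bit is `1` when the current
bit is `b` and the fractional coordinate moves from `y` to `y'`. -/
noncomputable def coupledOne (y y' : ℝ) (b : Bool) : ℝ :=
  if b = true ∧ y' - y < 0 then (y + (y' - y)) / y
  else if b = false ∧ 0 < y' - y then (y' - y) / (1 - y)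
  else if b = true then 1 else 0

/-- Coupled rounding: the probability that the state moves from `s` to `s'` when the fractional
state moves from `y` to `y'`; the coins of the different objects are independent. -/
noncomputable def coupledRound {N : ℕ} (y y' : Fin N → ℝ) (s s' : Fin N → Bool) : ℝ :=
  ∏ i, if s' i = true then coupledOne (y i) (y' i) (s i) else 1 - coupledOne (y i) (y' i) (s i)

/-- How the first integral state is drawn from the first fractional state. -/
inductive InitialRounding where
  | depRound
  | coinTosses

/-- Rounding schemes: dependent rounding with freezing period `M`, or coupled rounding. -/
inductive RoundingScheme where
  | depRound (M : ℕ)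
  | coupled (init : InitialRounding)

/-- Law of the first integral state, given the first fractional state. -/
noncomputable def initLaw {N : ℕ} (pick : (Fin N → ℝ) → Fin N × Fin N) :
    RoundingScheme → (Fin N → ℝ) → (Fin N → Bool) → ℝ
  | .depRound _ => depRound pick
  | .coupled .depRound => depRound pick
  | .coupled .coinTosses => coinTosses

open Classical in
/-- `stepLaw pick scheme t y y' s s'`: the probability that the state after the `t`-th request
(`t = 1, 2, …`) is `s'` when it was `s` before and the fractional state moves from `y` to `y'`. -/
noncomputable def stepLaw {N : ℕ} (pick : (Fin N → ℝ) → Fin N × Fin N) :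
    RoundingScheme → ℕ → (Fin N → ℝ) → (Fin N → ℝ) → (Fin N → Bool) → (Fin N → Bool) → ℝ
  | .depRound M, t, _, y', s, s' =>
      if M ∣ t then depRound pick y' s' else if s' = s then 1 else 0
  | .coupled _, _, y, y', s, s' => coupledRound y y' s s'

/-- The probability of the trajectory `w` of integral states over the horizon `T`, for the sequence
`y` of fractional states. -/
noncomputable def trajLaw {N : ℕ} (pick : (Fin N → ℝ) → Fin N × Fin N)
    (scheme : RoundingScheme) (y : ℕ → Fin N → ℝ) (T : ℕ) (w : Fin T → Fin N → Bool) : ℝ :=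
  ∏ t : Fin T, match t with
    | ⟨0, h0⟩ => initLaw pick scheme (y 0) (w ⟨0, h0⟩)
    | ⟨u + 1, hu⟩ => stepLaw pick scheme (u + 1) (y u) (y (u + 1))
        (w ⟨u, Nat.lt_of_succ_lt hu⟩) (w ⟨u + 1, hu⟩)

/-! ### Regret -/

/-- Expected total gain over the horizon `T` for the requests `r 0, …, r (T - 1)`. -/
noncomputable def expectedGain (pick : (Fin m.N → ℝ) → Fin m.N × Fin m.N)
    (scheme : RoundingScheme) (y : ℕ → Fin m.N → ℝ) (T : ℕ) (r : ℕ → R) : ℝ :=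
  ∑ w : Fin T → Fin m.N → Bool,
    trajLaw pick scheme y T w * ∑ t : Fin T, m.gain (r t) (augment (bits (w t)))

/-- Total gain of the best static valid cache state in hindsight. -/
noncomputable def bestStaticGain (T : ℕ) (r : ℕ → R) : ℝ :=
  ⨆ x : m.states, ∑ t : Fin T, m.gain (r t) x.1

/-- The `ψ`-regret over the horizon `T` of online mirror ascent with mirror map `Φ : D → ℝ`,
learning rate `η`, subgradients `sub` and the given rounding scheme: the supremum over all request
sequences (only the first `T` requests matter). -/
noncomputable def regret (ψ : ℝ) (Φ : (Fin m.N → ℝ) → ℝ) (D : Set (Fin m.N → ℝ)) (η : ℝ)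
    (sub : R → (Fin m.N → ℝ) → Fin m.N → ℝ) (pick : (Fin m.N → ℝ) → Fin m.N × Fin m.N)
    (scheme : RoundingScheme) (T : ℕ) : EReal :=
  ⨆ r : ℕ → R, ((ψ * m.bestStaticGain T r -
    m.expectedGain pick scheme (m.oma Φ D η sub r) T r : ℝ) : EReal)

/-- The learning rate, where `B` bounds the dissimilarity costs of the `k`-th closest objects. -/
noncomputable def learningRate (B : ℝ) (T : ℕ) : ℝ :=
  1 / (B + m.cf) * √(2 * Real.log ((m.N : ℝ) / m.h) / T)

end SimilarityCache

/-!
Two facts carry the theorem.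

*The fractional states have low regret* (`oma_regret_le`). The fractional gain is a concave
function whose subgradients have coordinates between `0` and `B + c_f`, where `B` bounds the
`k`-th smallest dissimilarity costs, because one more copy of
an object in the cache saves at most the cost of the `k`-th closest server copy
(`IsSubgradient.nonneg`, `IsSubgradient.le`); the closed-form direction is such a subgradient on the
unit cube. The convex hull of the valid states is the hypersimplex (`mem_fracStates_iff`), on which
the relative-entropy projection is explicit: `z ↦ min 1 (c z)`. It satisfies the generalized
Pythagorean inequality and is the unique minimizer, so every choice of minimizer in the algorithm is
this one (`argminOn_spec`). The usual potential argument with the relative entropy to the comparator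
then bounds the regret. All states have the same sum, so a constant may be subtracted from the
direction to make it nonpositive, and the elementary bound `exp (-b) ≤ 1 - b + b² / 2` then gives the
right constant without Pinsker's inequality (`mirrorStep_spec`).

*Rounding loses at most a factor `1 - 1 / e`* (`IsNegCorrelatedRounding.gain_le`). On integral
states the gain is the fractional gain, by Abel summation (`gain_augment_bits`), and the latter is a
nonnegative combination of functions `min c (∑ l ∈ A, y l)` with integers `c ≥ 1`. Such a function
lies above `c (1 - ∏ l ∈ A, (1 - y l / c))`, which is at least `1 - 1 / e` times it. Both rounding
schemes make the expectation of such a product at most the product at the fractional state: a step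
of dependent rounding moves two coordinates in opposite directions without drift, and a step of
coupled rounding substitutes nondecreasing affine functions of the current bits
(`isNegCorrelatedRounding_stateLaw`).
-/

namespace SimilarityCache

variable {R : Type*} (m : SimilarityCache R)

/-! ### Positions in the order of a request -/

/-- The position of an element of the augmented catalog in the order of `r`. -/
noncomputable def pos (r : R) (u : Fin m.N ⊕ Fin m.N) : ℕ :=
  Function.invFunOn (m.order r) (Set.Icc 1 (2 * m.N)) u

theorem pos_mem (r : R) (u : Fin m.N ⊕ Fin m.N) : m.pos r u ∈ Set.Icc 1 (2 * m.N) :=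
  Function.invFunOn_mem ((m.order_bijOn r).surjOn (Set.mem_univ u))

theorem order_pos (r : R) (u : Fin m.N ⊕ Fin m.N) : m.order r (m.pos r u) = u :=
  Function.invFunOn_eq ((m.order_bijOn r).surjOn (Set.mem_univ u))

theorem pos_order (r : R) {i : ℕ} (hi : i ∈ Set.Icc 1 (2 * m.N)) :
    m.pos r (m.order r i) = i :=
  (m.order_bijOn r).injOn (m.pos_mem r _) hi (m.order_pos r _)

theorem cost_order_mono (r : R) {i j : ℕ} (hi : 1 ≤ i) (hij : i ≤ j) (hj : j ≤ 2 * m.N) :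
    m.cost r (m.order r i) ≤ m.cost r (m.order r j) :=
  m.order_monotoneOn r ⟨hi, hij.trans hj⟩ ⟨hi.trans hij, hj⟩ hij

theorem pos_lt_of_cost_lt (r : R) {u v : Fin m.N ⊕ Fin m.N} (h : m.cost r u < m.cost r v) :
    m.pos r u < m.pos r v := by
  by_contra hc
  have := m.cost_order_mono r (m.pos_mem r v).1 (not_lt.1 hc) (m.pos_mem r u).2
  rw [order_pos, order_pos] at this
  linarith

theorem pos_inl_lt_pos_inr (r : R) (l : Fin m.N) :
    m.pos r (Sum.inl l) < m.pos r (Sum.inr l) := by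
  apply m.pos_lt_of_cost_lt
  have := m.cf_pos
  simp [cost, this]

theorem rank_eq_pos (r : R) (l : Fin m.N) : m.rank r l = m.pos r (Sum.inl l) := by
  have : {i | i ∈ Set.Icc 1 (2 * m.N) ∧ m.order r i = Sum.inl l} = {m.pos r (Sum.inl l)} := by
    ext i
    constructor
    · rintro ⟨hi, h⟩
      rw [Set.mem_singleton_iff, ← h, m.pos_order r hi]
    · rintro rfl
      exact ⟨m.pos_mem r _, m.order_pos r _⟩
  rw [rank, this, csInf_singleton]

/-- The objects whose local copy, but not whose server copy, is among the `i` closest elements. -/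
noncomputable def active (r : R) (i : ℕ) : Finset (Fin m.N) :=
  {l | m.pos r (Sum.inl l) ≤ i ∧ i < m.pos r (Sum.inr l)}

theorem prefixSum_eq_sum_pos_le (r : R) (x : Fin m.N ⊕ Fin m.N → ℝ) {i : ℕ}
    (hi : i ≤ 2 * m.N) : m.prefixSum r x i = ∑ u with m.pos r u ≤ i, x u := by
  refine Finset.sum_nbij (m.order r) ?_ ?_ ?_ (fun _ _ => rfl)
  · intro j hj
    obtain ⟨h1, h2⟩ := Finset.mem_Icc.1 hj
    simp [m.pos_order r ⟨h1, h2.trans hi⟩, h2]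
  · exact (m.order_bijOn r).injOn.mono fun j hj => by
      obtain ⟨h1, h2⟩ := Finset.mem_Icc.1 (Finset.mem_coe.1 hj)
      exact ⟨h1, h2.trans hi⟩
  · intro u hu
    refine ⟨m.pos r u, ?_, m.order_pos r u⟩
    have h : m.pos r u ≤ i := by simpa using hu
    simpa using ⟨(m.pos_mem r u).1, h⟩

theorem sigma_eq_prefixSum (r : R) (i : ℕ) :
    (m.sigma r i : ℝ) = m.prefixSum r (augment 0) i := by
  rw [sigma, Finset.card_filter, prefixSum, Nat.cast_sum]
  refine Finset.sum_congr rfl fun j _ => ?_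
  cases m.order r j <;> simp [augment]

/-- An object with both copies among the `i` closest elements contributes `1`, like its server copy
when the cache is empty; the local copy always comes before the server copy since `c_f > 0`. -/
theorem prefixSum_augment (r : R) (y : Fin m.N → ℝ) {i : ℕ} (hi : i ≤ 2 * m.N) :
    m.prefixSum r (augment y) i = m.sigma r i + ∑ l ∈ m.active r i, y l := by
  rw [sigma_eq_prefixSum, prefixSum_eq_sum_pos_le _ _ _ hi, prefixSum_eq_sum_pos_le _ _ _ hi,
    active, Finset.sum_filter, Finset.sum_filter, Finset.sum_filter,
    Fintype.sum_sum_type, Fintype.sum_sum_type, ← Finset.sum_add_distrib,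
    ← Finset.sum_add_distrib, ← Finset.sum_add_distrib]
  refine Finset.sum_congr rfl fun l _ => ?_
  have := m.pos_inl_lt_pos_inr r l
  by_cases h1 : m.pos r (Sum.inl l) ≤ i <;> by_cases h2 : m.pos r (Sum.inr l) ≤ i
  · simp [augment, h1, h2, not_lt.2 h2]
  · simp [augment, h1, h2, not_le.1 h2]
  · omega
  · simp [h1, h2]

theorem sigma_mono (r : R) : Monotone (m.sigma r) := fun _ _ h =>
  Finset.card_le_card (Finset.filter_subset_filter _ (Finset.Icc_subset_Icc_right h))

theorem sigma_succ_le (r : R) (i : ℕ) : m.sigma r (i + 1) ≤ m.sigma r i + 1 := by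
  rw [sigma, ← Finset.insert_Icc_right_eq_Icc_add_one (by omega), Finset.filter_insert]
  split_ifs
  · exact Finset.card_insert_le _ _
  · exact Nat.le_succ _

theorem sigma_two_mul (r : R) : m.sigma r (2 * m.N) = m.N := by
  have h := m.sigma_eq_prefixSum r (2 * m.N)
  rw [prefixSum_eq_sum_pos_le _ _ _ le_rfl, Finset.filter_true_of_mem fun u _ => (m.pos_mem r u).2,
    Fintype.sum_sum_type] at h
  simpa [augment] using h

theorem exists_sigma_eq (r : R) :
    ∃ i ≤ 2 * m.N, m.sigma r i = m.k ∧ ∀ j < i, m.sigma r j < m.k := by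
  classical
  have hex : ∃ i, m.k ≤ m.sigma r i := ⟨2 * m.N, by rw [sigma_two_mul]; exact m.k_le_N⟩
  have hlt : ∀ j < Nat.find hex, m.sigma r j < m.k := fun j hj => not_le.1 (Nat.find_min hex hj)
  refine ⟨Nat.find hex, Nat.find_min' hex (by rw [sigma_two_mul]; exact m.k_le_N), ?_, hlt⟩
  refine le_antisymm ?_ (Nat.find_spec hex)
  rcases h : Nat.find hex with _ | n
  · simp [sigma]
  · have := hlt n (by omega)
    have := m.sigma_succ_le r n
    omega

/-- `σ` starts at `0`, ends at `N ≥ k` and grows by steps of at most `1`, so the infimum defining `K`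
is attained, and `σ < k` before it. -/
theorem bigK_spec (r : R) :
    m.bigK r ≤ 2 * m.N ∧ m.sigma r (m.bigK r) = m.k ∧ ∀ j < m.bigK r, m.sigma r j < m.k := by
  obtain ⟨i, hi, h1, h2⟩ := m.exists_sigma_eq r
  have : m.bigK r = i := by
    apply le_antisymm
    · exact Nat.sInf_le h1
    · by_contra hc
      have hs : m.sigma r (m.bigK r) = m.k := Nat.sInf_mem (s := {i | m.sigma r i = m.k}) ⟨i, h1⟩
      exact (h2 _ (not_le.1 hc)).ne hs
  rw [this]
  exact ⟨hi, h1, h2⟩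

theorem one_le_bigK (r : R) : 1 ≤ m.bigK r := by
  by_contra hc
  have h := (m.bigK_spec r).2.1
  rw [show m.bigK r = 0 by omega] at h
  have := m.one_le_k
  simp [sigma] at h
  omega

theorem alpha_nonneg (r : R) {i : ℕ} (hi : i ∈ Finset.Ico 1 (m.bigK r)) : 0 ≤ m.alpha r i := by
  obtain ⟨h1, h2⟩ := Finset.mem_Ico.1 hi
  exact sub_nonneg.2 (m.cost_order_mono r h1 (by omega) (by have := (m.bigK_spec r).1; omega))

theorem sum_alpha_Ico (r : R) {a b : ℕ} (hab : a ≤ b) :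
    ∑ i ∈ Finset.Ico a b, m.alpha r i = m.cost r (m.order r b) - m.cost r (m.order r a) :=
  Finset.sum_Ico_sub (fun i => m.cost r (m.order r i)) hab

theorem cost_nonneg (r : R) (u : Fin m.N ⊕ Fin m.N) : 0 ≤ m.cost r u := by
  rcases u with o | o
  · exact m.cd_nonneg r o
  · exact add_nonneg (m.cd_nonneg r o) m.cf_pos.le

theorem kthDissimilarity_nonneg (r : R) : 0 ≤ m.kthDissimilarity r := m.cd_nonneg r _

/-- Otherwise the server copies of the `k` closest objects would all come before position `K`,
against the minimality of `K`. -/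
theorem cost_order_bigK_le (r : R) :
    m.cost r (m.order r (m.bigK r)) ≤ m.kthDissimilarity r + m.cf := by
  by_contra! hc
  obtain ⟨hK, -, hlt⟩ := m.bigK_spec r
  have h1 := m.one_le_bigK r
  have hcard := hlt (m.bigK r - 1) (by omega)
  refine absurd hcard (not_lt.2 ?_)
  have hkN := m.k_le_N
  have hk1 := m.one_le_k
  let f : Fin m.k → ℕ := fun a => m.pos r (Sum.inr (Tuple.sort (m.cd r) (Fin.castLE hkN a)))
  have hinj : Function.Injective f := by
    intro a b hab
    have := congrArg (m.order r) hab
    simp only [f, order_pos, Sum.inr.injEq, EmbeddingLike.apply_eq_iff_eq] at this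
    exact Fin.castLE_injective hkN this
  have hsub : Finset.univ.map ⟨f, hinj⟩ ⊆
      (Finset.Icc 1 (m.bigK r - 1)).filter (fun j => (m.order r j).isRight = true) := by
    intro j hj
    obtain ⟨a, -, rfl⟩ := Finset.mem_map.1 hj
    have hle : m.cd r (Tuple.sort (m.cd r) (Fin.castLE hkN a)) ≤ m.kthDissimilarity r :=
      Tuple.monotone_sort (m.cd r) (Fin.le_def.2 (by have := a.2; simp; omega))
    have hpos : f a < m.pos r (m.order r (m.bigK r)) := by
      apply m.pos_lt_of_cost_lt
      refine lt_of_le_of_lt ?_ hc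
      simpa [cost] using hle
    rw [m.pos_order r ⟨h1, hK⟩] at hpos
    have := (m.pos_mem r (Sum.inr (Tuple.sort (m.cd r) (Fin.castLE hkN a)))).1
    simp only [Finset.mem_filter, Finset.mem_Icc, Function.Embedding.coeFn_mk]
    refine ⟨⟨this, by omega⟩, ?_⟩
    simp [f, order_pos]
  simpa [sigma] using Finset.card_le_card hsub

theorem sum_alpha_le (r : R) :
    ∑ i ∈ Finset.Ico 1 (m.bigK r), m.alpha r i ≤ m.kthDissimilarity r + m.cf := by
  rw [sum_alpha_Ico _ _ (m.one_le_bigK r)]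
  have := m.cost_order_bigK_le r
  have := m.cost_nonneg r (m.order r 1)
  linarith

theorem fracGain_eq (r : R) (y : Fin m.N → ℝ) :
    m.fracGain r y = ∑ i ∈ Finset.Ico 1 (m.bigK r), m.alpha r i *
      min ((m.k : ℝ) - m.sigma r i) (∑ l ∈ m.active r i, y l) := by
  refine Finset.sum_congr rfl fun i hi => ?_
  have := (m.bigK_spec r).1
  rw [prefixSum_augment _ _ _ (by have := Finset.mem_Ico.1 hi; omega), add_sub_cancel_left]

/-! ### The gain of an integral state -/

theorem bits_mem_zero_one {n : ℕ} (s : Fin n → Bool) (i : Fin n) : bits s i = 0 ∨ bits s i = 1 := by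
  cases h : s i <;> simp [bits, h]

theorem augment_bits_mem_zero_one {n : ℕ} (s : Fin n → Bool) (u : Fin n ⊕ Fin n) :
    augment (bits s) u = 0 ∨ augment (bits s) u = 1 := by
  rcases u with i | i <;> rcases bits_mem_zero_one s i with h | h <;> simp [augment, h]

theorem prefixSum_succ (r : R) (x : Fin m.N ⊕ Fin m.N → ℝ) (i : ℕ) :
    m.prefixSum r x (i + 1) = m.prefixSum r x i + x (m.order r (i + 1)) :=
  Finset.sum_Icc_succ_top (by omega) _

theorem exists_prefixSum_eq_natCast (r : R) {x : Fin m.N ⊕ Fin m.N → ℝ}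
    (hx : ∀ u, x u = 0 ∨ x u = 1) (i : ℕ) : ∃ n : ℕ, m.prefixSum r x i = n := by
  induction i with
  | zero => exact ⟨0, by simp [prefixSum]⟩
  | succ i ih =>
    obtain ⟨n, hn⟩ := ih
    rcases hx (m.order r (i + 1)) with h | h
    · exact ⟨n, by rw [prefixSum_succ, hn, h, add_zero]⟩
    · exact ⟨n + 1, by rw [prefixSum_succ, hn, h]; push_cast; rfl⟩

/-- Abel summation: the element at position `i` is served iff `min k (x_{π_1} + ⋯ + x_{π_i})`
jumps at `i`. -/
theorem serviceCost_partial (r : R) {x : Fin m.N ⊕ Fin m.N → ℝ} (hx : ∀ u, x u = 0 ∨ x u = 1)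
    (n : ℕ) :
    ∑ i ∈ Finset.Icc 1 (n + 1), m.cost r (m.order r i) * x (m.order r i) *
      (if m.prefixSum r x (i - 1) < (m.k : ℝ) then 1 else 0) =
    m.cost r (m.order r (n + 1)) * min (m.k : ℝ) (m.prefixSum r x (n + 1)) -
      ∑ i ∈ Finset.Ico 1 (n + 1), m.alpha r i * min (m.k : ℝ) (m.prefixSum r x i) := by
  have key : ∀ i, x (m.order r (i + 1)) *
      (if m.prefixSum r x i < (m.k : ℝ) then 1 else 0) =
      min (m.k : ℝ) (m.prefixSum r x (i + 1)) - min (m.k : ℝ) (m.prefixSum r x i) := by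
    intro i
    obtain ⟨a, ha⟩ := m.exists_prefixSum_eq_natCast r hx i
    rw [prefixSum_succ, ha]
    by_cases hak : a < m.k
    · have h1 : (a : ℝ) < m.k := by exact_mod_cast hak
      have h2 : (a : ℝ) + 1 ≤ m.k := by exact_mod_cast hak
      rcases hx (m.order r (i + 1)) with h | h <;> simp [h, h1, h1.le, h2]
    · have h1 : (m.k : ℝ) ≤ a := by exact_mod_cast not_lt.1 hak
      rcases hx (m.order r (i + 1)) with h | h
      · simp [h]
      · rw [if_neg (not_lt.2 h1), min_eq_left h1, min_eq_left (by rw [h]; linarith)]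
        simp
  induction n with
  | zero =>
    have := key 0
    simp only [zero_add] at this
    simp only [zero_add, Finset.Icc_self, Finset.sum_singleton, Finset.Ico_self, Finset.sum_empty,
      sub_zero, Nat.sub_self, mul_assoc, this]
    simp [prefixSum]
  | succ n ih =>
    rw [Finset.sum_Icc_succ_top (by omega), ih,
      Finset.sum_Ico_succ_top (show 1 ≤ n + 1 by omega),
      Nat.add_sub_cancel, mul_assoc, key, alpha]
    ring

theorem serviceCost_augment_bits (r : R) (s : Fin m.N → Bool) :
    m.serviceCost r (augment (bits s)) = m.cost r (m.order r (2 * m.N)) * m.k -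
      ∑ i ∈ Finset.Ico 1 (2 * m.N), m.alpha r i *
        min (m.k : ℝ) (m.prefixSum r (augment (bits s)) i) := by
  have h1 := m.one_le_h
  have h2 := m.h_le_N
  obtain ⟨n, hn⟩ : ∃ n, 2 * m.N = n + 1 := ⟨2 * m.N - 1, by omega⟩
  have htop : (m.k : ℝ) ≤ m.prefixSum r (augment (bits s)) (2 * m.N) := by
    rw [prefixSum_augment _ _ _ le_rfl, sigma_two_mul]
    have : (m.k : ℝ) ≤ m.N := by exact_mod_cast m.k_le_N
    have : 0 ≤ ∑ l ∈ m.active r (2 * m.N), bits s l :=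
      Finset.sum_nonneg fun l _ => by rcases bits_mem_zero_one s l with h | h <;> simp [h]
    linarith
  have := m.serviceCost_partial r (augment_bits_mem_zero_one s) n
  rw [← hn, min_eq_left htop] at this
  rw [serviceCost, ← this]

/-- On integral states, valid or not, the fractional gain is the gain. -/
theorem gain_augment_bits (r : R) (s : Fin m.N → Bool) :
    m.gain r (augment (bits s)) = m.fracGain r (bits s) := by
  have h0 : (Sum.elim (fun _ => 0) (fun _ => 1) : Fin m.N ⊕ Fin m.N → ℝ) =
      augment (bits fun _ => false) := by
    ext u; rcases u with i | i <;> simp [augment, bits]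
  have hb : (bits fun _ : Fin m.N => false) = 0 := by ext; simp [bits]
  obtain ⟨hK, hKk, hlt⟩ := m.bigK_spec r
  rw [gain, h0, serviceCost_augment_bits, serviceCost_augment_bits, sub_sub_sub_cancel_left,
    ← Finset.sum_sub_distrib, fracGain_eq]
  symm
  refine Finset.sum_subset_zero_on_sdiff (Finset.Ico_subset_Ico_right hK) ?_ ?_
  · intro i hi
    obtain ⟨hi, hi'⟩ := Finset.mem_sdiff.1 hi
    obtain ⟨h1, h2⟩ := Finset.mem_Ico.1 hi
    have hKi : m.bigK r ≤ i := by simp only [Finset.mem_Ico] at hi'; omega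
    have hσ : (m.k : ℝ) ≤ m.sigma r i := by exact_mod_cast hKk ▸ m.sigma_mono r hKi
    have hnn : 0 ≤ ∑ l ∈ m.active r i, bits s l :=
      Finset.sum_nonneg fun l _ => by rcases bits_mem_zero_one s l with h | h <;> simp [h]
    rw [← mul_sub, prefixSum_augment _ _ _ h2.le, prefixSum_augment _ _ _ h2.le, hb,
      min_eq_left (by linarith), min_eq_left (by simpa using hσ), sub_self, mul_zero]
  · intro i hi
    obtain ⟨h1, h2⟩ := Finset.mem_Ico.1 hi
    have hσ : (m.sigma r i : ℝ) ≤ m.k := by exact_mod_cast (hlt i h2).le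
    rw [← mul_sub, prefixSum_augment _ _ _ (by omega), prefixSum_augment _ _ _ (by omega),
      hb]
    simp only [Pi.zero_apply, Finset.sum_const_zero, add_zero]
    rw [min_eq_right hσ, ← min_sub_sub_right, add_sub_cancel_left]

/-! ### Subgradients of the fractional gain -/

theorem fracGain_mono (r : R) : Monotone (m.fracGain r) := by
  intro y y' h
  rw [fracGain_eq, fracGain_eq]
  exact Finset.sum_le_sum fun i hi => mul_le_mul_of_nonneg_left
    (min_le_min_left _ (Finset.sum_le_sum fun l _ => h l)) (m.alpha_nonneg r hi)

theorem fracGain_add_single_le (r : R) (y : Fin m.N → ℝ) (l : Fin m.N) :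
    m.fracGain r (y + Pi.single l 1) ≤ m.fracGain r y + (m.kthDissimilarity r + m.cf) := by
  refine le_trans ?_ (add_le_add_right (m.sum_alpha_le r) _)
  rw [fracGain_eq, fracGain_eq, ← Finset.sum_add_distrib]
  refine Finset.sum_le_sum fun i hi => ?_
  have hone : ∑ j ∈ m.active r i, (Pi.single l 1 : Fin m.N → ℝ) j ≤ 1 := by
    simp only [Pi.single_apply, Finset.sum_ite_eq']
    split_ifs <;> norm_num
  have : min ((m.k : ℝ) - m.sigma r i) (∑ j ∈ m.active r i, (y + Pi.single l 1 : _ → ℝ) j) ≤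
      min ((m.k : ℝ) - m.sigma r i) (∑ j ∈ m.active r i, y j) + 1 := by
    simp only [Pi.add_apply, Finset.sum_add_distrib]
    rw [← min_add_add_right]
    exact min_le_min (by linarith) (by linarith)
  have := mul_le_mul_of_nonneg_left this (m.alpha_nonneg r hi)
  linarith

variable {m}

/-- Compare with the point where coordinate `l` is larger by `1`. -/
theorem IsSubgradient.nonneg {r : R} {y g : Fin m.N → ℝ} (hg : m.IsSubgradient r y g)
    (l : Fin m.N) : 0 ≤ g l := by
  have h := hg (y + Pi.single l 1)
  have h' : m.fracGain r y ≤ m.fracGain r (y + Pi.single l 1) :=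
    m.fracGain_mono r (le_add_of_nonneg_right (Pi.single_nonneg.2 zero_le_one))
  simp [Pi.single_apply] at h
  linarith

/-- Compare with the point where coordinate `l` is smaller by `1`. -/
theorem IsSubgradient.le {r : R} {y g : Fin m.N → ℝ} (hg : m.IsSubgradient r y g)
    (l : Fin m.N) : g l ≤ m.kthDissimilarity r + m.cf := by
  have h := hg (y - Pi.single l 1)
  have h' := m.fracGain_add_single_le r (y - Pi.single l 1) l
  rw [sub_add_cancel] at h'
  simp [Pi.single_apply] at h
  linarith

variable (m)

theorem prefixSum_augment_mono (r : R) {y : Fin m.N → ℝ} (hy : ∀ i, y i ∈ Set.Icc (0 : ℝ) 1) :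
    Monotone (m.prefixSum r (augment y)) := fun _ _ h =>
  Finset.sum_le_sum_of_subset_of_nonneg (Finset.Icc_subset_Icc_right h) fun j _ _ => by
    rcases m.order r j with l | l <;> simp [augment, (hy l).1, (hy l).2]

theorem forall_order_ne_inr_iff (r : R) (l : Fin m.N) {i : ℕ} (hi : i ≤ 2 * m.N) :
    (∀ v ∈ Set.Icc 1 i, m.order r v ≠ Sum.inr l) ↔ i < m.pos r (Sum.inr l) := by
  constructor
  · intro h
    by_contra hc
    exact h _ ⟨(m.pos_mem r _).1, not_lt.1 hc⟩ (m.order_pos r _)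
  · rintro h v ⟨hv1, hv2⟩ hv
    have := m.pos_order r ⟨hv1, hv2.trans hi⟩
    rw [hv] at this
    omega

/-- `lastActive` is the right end of the interval of the positions `i` it is defined from. -/
theorem le_lastActive_iff (r : R) {y : Fin m.N → ℝ} (hy : ∀ i, y i ∈ Set.Icc (0 : ℝ) 1)
    (l : Fin m.N) {i : ℕ} (hi : 1 ≤ i) :
    i ≤ m.lastActive r y l ↔ i < m.bigK r ∧ m.prefixSum r (augment y) i ≤ m.k ∧
      i < m.pos r (Sum.inr l) := by
  have hK := (m.bigK_spec r).1
  set Z := {i | i ∈ Set.Icc 1 (m.bigK r - 1) ∧ m.prefixSum r (augment y) i ≤ (m.k : ℝ) ∧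
    ∀ v ∈ Set.Icc 1 i, m.order r v ≠ Sum.inr l} with hZ
  have hmem : ∀ {i}, 1 ≤ i → (i ∈ Z ↔ i < m.bigK r ∧ m.prefixSum r (augment y) i ≤ m.k ∧
      i < m.pos r (Sum.inr l)) := by
    intro i hi
    have : i ∈ Set.Icc 1 (m.bigK r - 1) ↔ i < m.bigK r := by
      simp only [Set.mem_Icc]; omega
    rw [hZ, Set.mem_ofPred_eq, this]
    refine and_congr_right fun h => ?_
    rw [m.forall_order_ne_inr_iff r l (by omega)]
  have hbdd : BddAbove Z := ⟨m.bigK r - 1, fun j hj => hj.1.2⟩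
  change i ≤ sSup Z ↔ _
  rw [← hmem hi]
  constructor
  · intro h
    have hne : Z.Nonempty := by
      by_contra hc
      rw [Set.not_nonempty_iff_eq_empty.1 hc] at h
      simp at h
      omega
    have hs := Nat.sSup_mem hne hbdd
    rw [hmem (hi.trans h)] at hs
    exact (hmem hi).2 ⟨by omega, (m.prefixSum_augment_mono r hy h).trans hs.2.1, by omega⟩
  · exact fun h => le_csSup hbdd h

/-- The differences of costs in the closed form are telescoping sums of `α_i`. -/
theorem explicitSubgradient_eq_sum (r : R) {y : Fin m.N → ℝ} (hy : ∀ i, y i ∈ Set.Icc (0 : ℝ) 1)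
    (l : Fin m.N) : m.explicitSubgradient r y l =
      ∑ i ∈ Finset.Ico 1 (m.bigK r), m.alpha r i *
        (if m.prefixSum r (augment y) i ≤ m.k then (if l ∈ m.active r i then 1 else 0) else 0) := by
  have hp := (m.pos_mem r (Sum.inl l)).1
  have h1 : ∑ i ∈ Finset.Ico 1 (m.bigK r), m.alpha r i *
      (if m.prefixSum r (augment y) i ≤ m.k then (if l ∈ m.active r i then 1 else 0) else 0) =
      ∑ i ∈ Finset.Ico (m.pos r (Sum.inl l)) (m.lastActive r y l + 1), m.alpha r i := by
    have : Finset.Ico (m.pos r (Sum.inl l)) (m.lastActive r y l + 1) =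
        (Finset.Ico 1 (m.bigK r)).filter fun i =>
          m.prefixSum r (augment y) i ≤ m.k ∧ l ∈ m.active r i := by
      ext i
      simp only [Finset.mem_Ico, Finset.mem_filter, active, Finset.mem_univ, true_and,
        Nat.lt_succ_iff]
      constructor
      · rintro ⟨ha, hb⟩
        obtain ⟨h1, h2, h3⟩ := (m.le_lastActive_iff r hy l (hp.trans ha)).1 hb
        exact ⟨⟨hp.trans ha, h1⟩, h2, ha, h3⟩
      · rintro ⟨⟨ha, hb⟩, h2, h3, h4⟩
        exact ⟨h3, (m.le_lastActive_iff r hy l ha).2 ⟨hb, h2, h4⟩⟩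
    rw [this, Finset.sum_filter]
    refine Finset.sum_congr rfl fun i _ => ?_
    by_cases ha : m.prefixSum r (augment y) i ≤ m.k <;> simp [ha]
  rw [h1, explicitSubgradient, rank_eq_pos]
  split_ifs with h
  · rw [sum_alpha_Ico _ _ (by omega), order_pos]
  · rw [Finset.Ico_eq_empty (by omega), Finset.sum_empty]

/-- The closed form selects, for every term `min (k - σ_i) (∑ l ∈ active i, y l)` of the fractional
gain, the gradient of the second argument if that argument is the minimum, and `0` otherwise. -/
theorem isSubgradient_explicitSubgradient (r : R) {y : Fin m.N → ℝ}
    (hy : ∀ i, y i ∈ Set.Icc (0 : ℝ) 1) : m.IsSubgradient r y (m.explicitSubgradient r y) := by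
  intro y'
  have hK := (m.bigK_spec r).1
  have hlin : ∑ l, m.explicitSubgradient r y l * (y' l - y l) =
      ∑ i ∈ Finset.Ico 1 (m.bigK r), m.alpha r i *
        (if m.prefixSum r (augment y) i ≤ m.k then ∑ l ∈ m.active r i, (y' l - y l) else 0) := by
    simp only [m.explicitSubgradient_eq_sum r hy, Finset.sum_mul]
    rw [Finset.sum_comm]
    refine Finset.sum_congr rfl fun i _ => ?_
    split_ifs
    · simp only [mul_assoc, ← Finset.mul_sum, ite_mul, one_mul, zero_mul]
      rw [Finset.sum_ite_mem, Finset.univ_inter]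
    · simp
  rw [hlin, fracGain_eq, fracGain_eq, ← Finset.sum_add_distrib]
  refine Finset.sum_le_sum fun i hi => ?_
  rw [← mul_add]
  refine mul_le_mul_of_nonneg_left ?_ (m.alpha_nonneg r hi)
  rw [prefixSum_augment _ _ _ (by have := Finset.mem_Ico.1 hi; omega)]
  split_ifs with h
  · rw [Finset.sum_sub_distrib, min_eq_right (b := ∑ l ∈ m.active r i, y l) (by linarith)]
    exact (min_le_right _ _).trans (by linarith)
  · rw [min_eq_left (b := ∑ l ∈ m.active r i, y l) (by linarith), add_zero]
    exact min_le_left _ _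

/-! ### Moving mass between two coordinates -/

theorem shift_apply {n : ℕ} (v : Fin n → ℝ) {i j : Fin n} (hij : i ≠ j) (a : ℝ) (l : Fin n) :
    shift v i j a l = if l = i then v i + a else if l = j then v j - a else v l := by
  by_cases hi : l = i
  · subst hi; simp [shift, hij]
  · by_cases hj : l = j
    · subst hj; simp [shift, hi]
    · simp [shift, hi, hj]

theorem sum_shift {n : ℕ} (v : Fin n → ℝ) (i j : Fin n) (a : ℝ) :
    ∑ l, shift v i j a l = ∑ l, v l := by
  simp [shift, Finset.sum_add_distrib]

theorem Unrounded.symm {n : ℕ} {v : Fin n → ℝ} {i j : Fin n} (h : Unrounded v i j) :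
    Unrounded v j i := ⟨h.1.symm, h.2.2, h.2.1⟩

theorem shift_mem_Icc {n : ℕ} {v : Fin n → ℝ} (hv : ∀ l, v l ∈ Set.Icc (0 : ℝ) 1) {i j : Fin n}
    (h : Unrounded v i j) (l : Fin n) :
    shift v i j (min (1 - v i) (v j)) l ∈ Set.Icc (0 : ℝ) 1 := by
  obtain ⟨hij, ⟨hi0, hi1⟩, hj0, hj1⟩ := h
  have h1 := min_le_left (1 - v i) (v j)
  have h2 := min_le_right (1 - v i) (v j)
  have h3 : 0 ≤ min (1 - v i) (v j) := le_min (by linarith) hj0.le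
  rw [shift_apply v hij]
  split_ifs
  · exact ⟨by linarith, by linarith⟩
  · exact ⟨by linarith, by linarith⟩
  · exact hv l

open Classical in
/-- The coordinates that are not rounded yet. -/
noncomputable def fractional {n : ℕ} (v : Fin n → ℝ) : Finset (Fin n) :=
  {l | v l ∈ Set.Ioo (0 : ℝ) 1}

theorem mem_fractional {n : ℕ} {v : Fin n → ℝ} {l : Fin n} :
    l ∈ fractional v ↔ v l ∈ Set.Ioo (0 : ℝ) 1 := by
  simp [fractional]

theorem card_fractional_shift_lt {n : ℕ} {v : Fin n → ℝ} {i j : Fin n} (h : Unrounded v i j) :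
    (fractional (shift v i j (min (1 - v i) (v j)))).card < (fractional v).card := by
  obtain ⟨hij, hi, hj⟩ := h
  apply Finset.card_lt_card
  refine Finset.ssubset_iff_subset_ne.2 ⟨fun l hl => ?_, fun heq => ?_⟩
  · rw [mem_fractional, shift_apply v hij] at hl
    rw [mem_fractional]
    split_ifs at hl with h1 h2
    · rwa [h1]
    · rwa [h2]
    · exact hl
  · have h1 := mem_fractional.1 (heq ▸ mem_fractional.2 hi)
    have h2 := mem_fractional.1 (heq ▸ mem_fractional.2 hj)
    rw [shift_apply v hij, if_pos rfl] at h1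
    rw [shift_apply v hij, if_neg hij.symm, if_pos rfl] at h2
    rcases min_cases (1 - v i) (v j) with ⟨h, -⟩ | ⟨h, -⟩
    · rw [h] at h1; linarith [h1.2]
    · rw [h] at h2; linarith [h2.1]

/-- A vector of `[0, 1]ⁿ` with integral sum cannot have exactly one coordinate in `(0, 1)`. -/
theorem exists_eq_bits_or_unrounded {n h : ℕ} {v : Fin n → ℝ}
    (hv : ∀ l, v l ∈ Set.Icc (0 : ℝ) 1) (hsum : ∑ l, v l = h) :
    (∃ s, v = bits s) ∨ ∃ i j, Unrounded v i j := by
  classical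
  by_cases hf : ∃ i, v i ∈ Set.Ioo (0 : ℝ) 1
  · right
    obtain ⟨i, hi⟩ := hf
    by_contra! hc
    have hint : ∀ j ∈ Finset.univ.erase i, v j = ((if v j = 1 then 1 else 0 : ℕ) : ℝ) := by
      intro j hj
      have hji := Finset.ne_of_mem_erase hj
      have hnot : v j ∉ Set.Ioo (0 : ℝ) 1 := fun hj => hc i j ⟨hji.symm, hi, hj⟩
      split_ifs with h1
      · simp [h1]
      · rcases (hv j).1.eq_or_lt with h0 | h0
        · simp [← h0]
        · exact absurd ⟨h0, lt_of_le_of_ne (hv j).2 h1⟩ hnot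
    rw [← Finset.add_sum_erase _ _ (Finset.mem_univ i), Finset.sum_congr rfl hint,
      ← Nat.cast_sum] at hsum
    -- The other coordinates sum to a natural number, strictly between `h - 1` and `h`.
    set N := ∑ j ∈ Finset.univ.erase i, if v j = 1 then 1 else 0
    have h1 : (N : ℝ) < h := by linarith [hi.1]
    have h2 : (h : ℝ) < N + 1 := by linarith [hi.2]
    have h3 : N < h := by exact_mod_cast h1
    have h4 : h < N + 1 := by exact_mod_cast h2
    omega
  · left
    refine ⟨fun l => decide (v l = 1), ?_⟩
    ext l
    by_cases h1 : v l = 1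
    · simp [bits, h1]
    · have : v l = 0 := by
        rcases (hv l).1.eq_or_lt with h0 | h0
        · exact h0.symm
        · exact absurd ⟨l, h0, lt_of_le_of_ne (hv l).2 h1⟩ hf
      simp [bits, this]

/-! ### Fractional states -/

theorem augment_bits_mem_states {s : Fin m.N → Bool} (hs : ∑ i, bits s i = m.h) :
    augment (bits s) ∈ m.states :=
  ⟨augment_bits_mem_zero_one s, hs, fun _ => rfl⟩

theorem exists_eq_augment_bits {x : Fin m.N ⊕ Fin m.N → ℝ} (hx : x ∈ m.states) :
    ∃ s : Fin m.N → Bool, x = augment (bits s) := by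
  classical
  obtain ⟨h01, -, hr⟩ := hx
  have hl : ∀ i, x (Sum.inl i) = bits (fun i => decide (x (Sum.inl i) = 1)) i := by
    intro i
    rcases h01 (Sum.inl i) with h | h <;> simp [bits, h]
  refine ⟨fun i => decide (x (Sum.inl i) = 1), ?_⟩
  ext u
  rcases u with i | i
  · exact hl i
  · rw [hr i, hl i]; rfl

/-- The convex hull of the valid states is the hypersimplex: moving mass between two fractional
coordinates in both directions writes a fractional point as a convex combination of points with
fewer fractional coordinates. -/
theorem mem_fracStates_iff {y : Fin m.N → ℝ} :
    y ∈ m.fracStates ↔ (∀ i, y i ∈ Set.Icc (0 : ℝ) 1) ∧ ∑ i, y i = m.h := by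
  constructor
  · intro hy
    let S : Set (Fin m.N ⊕ Fin m.N → ℝ) :=
      {x | (∀ i, x (Sum.inl i) ∈ Set.Icc (0 : ℝ) 1) ∧ ∑ i, x (Sum.inl i) = m.h}
    have hS : Convex ℝ S := by
      intro x hx x' hx' a b ha hb hab
      refine ⟨fun i => convex_Icc (0 : ℝ) 1 (hx.1 i) (hx'.1 i) ha hb hab, ?_⟩
      simp only [Pi.add_apply, Pi.smul_apply, smul_eq_mul, Finset.sum_add_distrib,
        ← Finset.mul_sum, hx.2, hx'.2]
      rw [← add_mul, hab, one_mul]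
    have hsub : m.states ⊆ S := by
      rintro x ⟨h01, hsum, -⟩
      refine ⟨fun i => ?_, hsum⟩
      rcases h01 (Sum.inl i) with h | h <;> simp [h]
    exact convexHull_min hsub hS hy
  · rintro ⟨hy, hsum⟩
    induction hc : (fractional y).card using Nat.strong_induction_on generalizing y with
    | _ c ih =>
      rcases exists_eq_bits_or_unrounded hy hsum with ⟨s, rfl⟩ | ⟨i, j, hij⟩
      · exact subset_convexHull ℝ _ (m.augment_bits_mem_states hsum)
      · have h1 := ih _ (hc ▸ card_fractional_shift_lt hij) (shift_mem_Icc hy hij)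
          ((sum_shift y i j _).trans hsum) rfl
        have h2 := ih _ (hc ▸ card_fractional_shift_lt hij.symm) (shift_mem_Icc hy hij.symm)
          ((sum_shift y j i _).trans hsum) rfl
        set a := min (1 - y i) (y j)
        set b := min (1 - y j) (y i)
        have ha : 0 < a := lt_min (by linarith [hij.2.1.2]) hij.2.2.1
        have hb : 0 < b := lt_min (by linarith [hij.2.2.2]) hij.2.1.1
        have := convex_convexHull ℝ m.states h1 h2 (a := b / (a + b)) (b := a / (a + b))
          (by positivity) (by positivity) (by field_simp; ring)
        suffices h : augment y = (b / (a + b)) • augment (shift y i j a) +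
            (a / (a + b)) • augment (shift y j i b) by
          change augment y ∈ convexHull ℝ m.states
          rwa [h]
        have hl : ∀ l, y l = b / (a + b) * shift y i j a l + a / (a + b) * shift y j i b l := by
          intro l
          rw [shift_apply y hij.1, shift_apply y hij.symm.1]
          split_ifs with h1 h2 h2
          · exact absurd (h1.symm.trans h2) hij.1
          · rw [h1]; field_simp; ring
          · rw [h2]; field_simp; ring
          · field_simp; ring
        ext u
        rcases u with l | l
        · simpa [augment] using hl l
        · have := hl l
          simp only [augment, Sum.elim_inr, Pi.add_apply, Pi.smul_apply, smul_eq_mul]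
          rw [mul_sub, mul_sub, mul_one, mul_one]
          have h1 : b / (a + b) + a / (a + b) = 1 := by field_simp; ring
          linarith

/-! ### Relative entropy and the mirror step -/

/-- The generalized relative entropy, i.e. the Bregman divergence of the negative entropy. It is
used for `x ≥ 0` and `y > 0`; `Real.log 0 = 0` gives the convention `0 log 0 = 0`. -/
noncomputable def relEntropy {n : ℕ} (x y : Fin n → ℝ) : ℝ :=
  ∑ i, (x i * Real.log (x i) - x i * Real.log (y i) - x i + y i)

theorem relEntropy_term_eq {a b : ℝ} (ha : 0 ≤ a) (hb : 0 < b) :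
    a * Real.log a - a * Real.log b - a + b = b * InformationTheory.klFun (a / b) := by
  rcases ha.eq_or_lt with rfl | ha
  · simp [InformationTheory.klFun]
  · rw [InformationTheory.klFun, Real.log_div ha.ne' hb.ne']
    field_simp
    ring

theorem relEntropy_nonneg {n : ℕ} {x y : Fin n → ℝ} (hx : ∀ i, 0 ≤ x i) (hy : ∀ i, 0 < y i) :
    0 ≤ relEntropy x y :=
  Finset.sum_nonneg fun i _ => by
    rw [relEntropy_term_eq (hx i) (hy i)]
    exact mul_nonneg (hy i).le (InformationTheory.klFun_nonneg (div_nonneg (hx i) (hy i).le))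

theorem eq_of_relEntropy_le_zero {n : ℕ} {x y : Fin n → ℝ} (hx : ∀ i, 0 ≤ x i)
    (hy : ∀ i, 0 < y i) (h : relEntropy x y ≤ 0) : x = y := by
  have h0 := le_antisymm h (relEntropy_nonneg hx hy)
  rw [relEntropy, Finset.sum_congr rfl fun i _ => relEntropy_term_eq (hx i) (hy i),
    Finset.sum_eq_zero_iff_of_nonneg fun i _ => mul_nonneg (hy i).le
      (InformationTheory.klFun_nonneg (div_nonneg (hx i) (hy i).le))] at h0
  ext i
  have := (mul_eq_zero.1 (h0 i (Finset.mem_univ i))).resolve_left (hy i).ne'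
  rw [InformationTheory.klFun_eq_zero_iff (div_nonneg (hx i) (hy i).le)] at this
  exact (div_eq_one_iff_eq (hy i).ne').1 this

theorem grad_negEntropy {n : ℕ} {z : Fin n → ℝ} (hz : z ∈ posOrthant n) (i : Fin n) :
    grad negEntropy z i = Real.log (z i) + 1 := by
  have h : HasFDerivAt (negEntropy : (Fin n → ℝ) → ℝ)
      (∑ j, (Real.log (z j) + 1) • (ContinuousLinearMap.proj j : (Fin n → ℝ) →L[ℝ] ℝ)) z := by
    refine HasFDerivAt.fun_sum fun j _ => ?_
    exact (Real.hasDerivAt_mul_log (hz j).ne').comp_hasFDerivAt z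
      (hasFDerivAt_apply (𝕜 := ℝ) j z)
  rw [grad, h.fderiv]
  simp [Pi.single_apply]

theorem bregman_negEntropy {n : ℕ} (y : Fin n → ℝ) {z : Fin n → ℝ} (hz : z ∈ posOrthant n) :
    bregman negEntropy y z = relEntropy y z := by
  rw [bregman, negEntropy, negEntropy, relEntropy, ← Finset.sum_sub_distrib,
    ← Finset.sum_sub_distrib]
  refine Finset.sum_congr rfl fun i _ => ?_
  rw [grad_negEntropy hz]
  ring

/-- The relative-entropy projection of `z` onto the hypersimplex is `min 1 (c zᵢ)`, with `c` chosen
such that the sum is right; it satisfies the generalized Pythagorean inequality. -/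
theorem exists_entropic_projection {z : Fin m.N → ℝ} (hz : ∀ i, 0 < z i) :
    ∃ y ∈ m.fracStates ∩ posOrthant m.N, ∀ x ∈ m.fracStates,
      relEntropy x y + relEntropy y z ≤ relEntropy x z := by
  -- The sum goes from `0` at `c = 0` to `N ≥ h` once `c ≥ 1 / z i` for all `i`.
  obtain ⟨c, hc, hsum⟩ : ∃ c : ℝ, 0 < c ∧ ∑ i, min 1 (c * z i) = m.h := by
    have hcont : Continuous fun c : ℝ => ∑ i, min 1 (c * z i) := by fun_prop
    have hN : 0 < m.N := m.one_le_h.trans m.h_le_N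
    have : Nonempty (Fin m.N) := ⟨⟨0, hN⟩⟩
    obtain ⟨b, hb⟩ : ∃ b, ∀ i, 1 / z i ≤ b := by
      obtain ⟨i, hi⟩ := Finite.exists_max fun i => 1 / z i
      exact ⟨_, hi⟩
    have hb0 : 0 ≤ b := (by have := hz ⟨0, hN⟩; positivity : 0 ≤ 1 / z ⟨0, hN⟩).trans (hb _)
    have htop : ∑ i, min 1 (b * z i) = m.N := by
      rw [Finset.sum_congr rfl fun i _ => min_eq_left ((div_le_iff₀ (hz i)).1 (hb i))]
      simp
    have h1 : (1 : ℝ) ≤ m.h := by exact_mod_cast m.one_le_h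
    have h2 : (m.h : ℝ) ≤ m.N := by exact_mod_cast m.h_le_N
    obtain ⟨c, hcm, hceq⟩ := intermediate_value_Icc hb0 hcont.continuousOn
      (show (m.h : ℝ) ∈ _ from ⟨by simp, by simpa [htop] using h2⟩)
    refine ⟨c, lt_of_le_of_ne hcm.1 ?_, hceq⟩
    rintro rfl
    simp at hceq
    linarith
  have hy0 : ∀ i, 0 < min 1 (c * z i) := fun i => lt_min one_pos (mul_pos hc (hz i))
  refine ⟨fun i => min 1 (c * z i), ⟨m.mem_fracStates_iff.2
    ⟨fun i => ⟨(hy0 i).le, min_le_left _ _⟩, hsum⟩, hy0⟩, fun x hx => ?_⟩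
  obtain ⟨hx01, hxsum⟩ := m.mem_fracStates_iff.1 hx
  have hzero : ∑ i, (x i - min 1 (c * z i)) * Real.log c = 0 := by
    rw [← Finset.sum_mul, Finset.sum_sub_distrib, hxsum, hsum, sub_self, zero_mul]
  rw [← sub_nonneg, ← hzero, relEntropy, relEntropy, relEntropy, ← Finset.sum_add_distrib,
    ← Finset.sum_sub_distrib]
  refine Finset.sum_le_sum fun i _ => ?_
  rcases le_total (c * z i) 1 with h | h
  · rw [min_eq_right h, Real.log_mul hc.ne' (hz i).ne']
    linarith
  · have hlog : 0 ≤ Real.log c + Real.log (z i) := by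
      rw [← Real.log_mul hc.ne' (hz i).ne']; exact Real.log_nonneg h
    rw [min_eq_left h, Real.log_one]
    nlinarith [(hx01 i).2]

/-- The strict convexity of the relative entropy makes the minimizer unique, so the arbitrary choice
in `argminOn` does not matter. -/
theorem argminOn_spec {z : Fin m.N → ℝ} (hz : ∀ i, 0 < z i) {f : (Fin m.N → ℝ) → ℝ} {c : ℝ}
    (hf : ∀ y ∈ m.fracStates ∩ posOrthant m.N, f y = relEntropy y z + c) :
    argminOn (m.fracStates ∩ posOrthant m.N) f ∈ m.fracStates ∩ posOrthant m.N ∧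
    ∀ x ∈ m.fracStates, relEntropy x (argminOn (m.fracStates ∩ posOrthant m.N) f) +
      relEntropy (argminOn (m.fracStates ∩ posOrthant m.N) f) z ≤ relEntropy x z := by
  obtain ⟨y, hy, hpyth⟩ := m.exists_entropic_projection hz
  have hnn : ∀ x ∈ m.fracStates, ∀ i, 0 ≤ x i := fun x hx i => ((m.mem_fracStates_iff.1 hx).1 i).1
  have hmin : IsMinOn f (m.fracStates ∩ posOrthant m.N) y := fun x hx => by
    change f y ≤ f x
    rw [hf y hy, hf x hx]
    linarith [hpyth x hx.1, relEntropy_nonneg (hnn x hx.1) hy.2]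
  obtain ⟨hS, hM⟩ := Classical.epsilon_spec
    (p := fun y => y ∈ m.fracStates ∩ posOrthant m.N ∧
      IsMinOn f (m.fracStates ∩ posOrthant m.N) y) ⟨y, hy, hmin⟩
  change argminOn (m.fracStates ∩ posOrthant m.N) f ∈ _ at hS
  change IsMinOn f _ (argminOn (m.fracStates ∩ posOrthant m.N) f) at hM
  set w := argminOn (m.fracStates ∩ posOrthant m.N) f
  have h1 : f w ≤ f y := hM hy
  rw [hf y hy, hf w hS] at h1
  have h2 := hpyth w hS.1
  rw [eq_of_relEntropy_le_zero (hnn w hS.1) hy.2 (by linarith)]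
  exact ⟨hy, hpyth⟩

/-- The distance from the initial fractional state to any other one is at most its distance from
the uniform vector to a vertex. -/
theorem initial_state_spec :
    argminOn (m.fracStates ∩ posOrthant m.N) negEntropy ∈ m.fracStates ∩ posOrthant m.N ∧
    ∀ x ∈ m.fracStates,
      relEntropy x (argminOn (m.fracStates ∩ posOrthant m.N) negEntropy) ≤
        m.h * Real.log ((m.N : ℝ) / m.h) := by
  have hone : ∀ x ∈ m.fracStates, relEntropy x 1 = negEntropy x - m.h + m.N := by
    intro x hx
    simp [relEntropy, negEntropy, Finset.sum_add_distrib, (m.mem_fracStates_iff.1 hx).2]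
  obtain ⟨hS, hpyth⟩ := m.argminOn_spec (z := 1) (f := negEntropy) (c := m.h - m.N)
    (fun i => zero_lt_one) (fun y hy => by rw [hone y hy.1]; ring)
  refine ⟨hS, fun x hx => ?_⟩
  have h := hpyth x hx
  set w := argminOn (m.fracStates ∩ posOrthant m.N) negEntropy
  rw [hone x hx, hone w hS.1] at h
  have hx0 : negEntropy x ≤ 0 := Finset.sum_nonpos fun i _ =>
    Real.mul_log_nonpos ((m.mem_fracStates_iff.1 hx).1 i).1 ((m.mem_fracStates_iff.1 hx).1 i).2
  have hh : (0 : ℝ) < m.h := by exact_mod_cast m.one_le_h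
  have hN : (0 : ℝ) < m.N := by exact_mod_cast m.one_le_h.trans m.h_le_N
  have hw := (m.mem_fracStates_iff.1 hS.1)
  have hu := relEntropy_nonneg (x := w) (y := fun _ => (m.h : ℝ) / m.N) (fun i => (hw.1 i).1)
    (fun _ => by positivity)
  have hu' : relEntropy w (fun _ => (m.h : ℝ) / m.N) =
      negEntropy w - m.h * Real.log ((m.h : ℝ) / m.N) := by
    simp only [relEntropy, negEntropy, Finset.sum_add_distrib, Finset.sum_sub_distrib,
      ← Finset.sum_mul, hw.2]
    simp
    field_simp
    ring
  rw [hu', Real.log_div hh.ne' hN.ne'] at hu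
  rw [Real.log_div hN.ne' hh.ne']
  linarith

theorem exp_neg_le_quadratic {b : ℝ} (hb : 0 ≤ b) : Real.exp (-b) ≤ 1 - b + b ^ 2 / 2 := by
  have h := Real.quadratic_le_exp_of_nonneg hb
  rw [Real.exp_neg, inv_le_comm₀ (Real.exp_pos b) (by nlinarith [sq_nonneg (b - 1)])]
  refine le_trans ?_ h
  rw [inv_le_iff_one_le_mul₀ (by nlinarith [sq_nonneg (b - 1)])]
  nlinarith [sq_nonneg (b ^ 2)]

/-- One step of mirror ascent. Since the coordinates of a state have a fixed sum, adding a constant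
to the direction does not change the step; after subtraction of `L` the direction is nonpositive,
and `exp (-b) ≤ 1 - b + b² / 2` for `b ≥ 0` replaces the strong convexity of the mirror map. -/
theorem mirrorStep_spec {η L : ℝ} (hη : 0 ≤ η) {y g : Fin m.N → ℝ}
    (hy : y ∈ m.fracStates ∩ posOrthant m.N) (hg0 : ∀ i, 0 ≤ g i) (hgL : ∀ i, g i ≤ L) :
    mirrorStep negEntropy (posOrthant m.N) m.fracStates η y g ∈ m.fracStates ∩ posOrthant m.N ∧
    ∀ x ∈ m.fracStates, η * ∑ i, g i * (x i - y i) ≤ relEntropy x y -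
      relEntropy x (mirrorStep negEntropy (posOrthant m.N) m.fracStates η y g) +
      m.h * (η * L) ^ 2 / 2 := by
  set D := posOrthant m.N
  have hex : grad negEntropy y + η • g ∈ grad negEntropy '' D := by
    refine ⟨fun i => y i * Real.exp (η * g i), fun i => mul_pos (hy.2 i) (Real.exp_pos _), ?_⟩
    ext i
    rw [grad_negEntropy (fun i => mul_pos (hy.2 i) (Real.exp_pos _)), Pi.add_apply,
      grad_negEntropy hy.2, Real.log_mul (hy.2 i).ne' (Real.exp_pos _).ne', Real.log_exp]
    simp
    ring
  set z := Function.invFunOn (grad negEntropy) D (grad negEntropy y + η • g)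
  have hz : z ∈ D := Function.invFunOn_mem hex
  have hzgrad : grad negEntropy z = grad negEntropy y + η • g := Function.invFunOn_eq hex
  have hzlog : ∀ i, Real.log (z i) = Real.log (y i) + η * g i := by
    intro i
    have := congrFun hzgrad i
    rw [grad_negEntropy hz, Pi.add_apply, grad_negEntropy hy.2] at this
    simp at this
    linarith
  -- `z'` is the unprojected iterate for the direction `g - L`.
  let b : Fin m.N → ℝ := fun i => η * (L - g i)
  have hb0 : ∀ i, 0 ≤ b i := fun i => mul_nonneg hη (by linarith [hgL i])
  have hbL : ∀ i, b i ≤ η * L := fun i => mul_le_mul_of_nonneg_left (by linarith [hg0 i]) hη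
  let z' : Fin m.N → ℝ := fun i => y i * Real.exp (-b i)
  have hz' : ∀ i, 0 < z' i := fun i => mul_pos (hy.2 i) (Real.exp_pos _)
  have hz'log : ∀ i, Real.log (z' i) = Real.log (y i) - b i := fun i => by
    rw [Real.log_mul (hy.2 i).ne' (Real.exp_pos _).ne', Real.log_exp]; ring
  obtain ⟨hS, hpyth⟩ := m.argminOn_spec (f := fun y' => bregman negEntropy y' z)
    (c := ∑ i, (z i - z' i) - m.h * (η * L)) hz' (by
      intro w hw
      rw [bregman_negEntropy w hz, relEntropy, relEntropy, ← (m.mem_fracStates_iff.1 hw.1).2,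
        Finset.sum_mul, ← Finset.sum_sub_distrib, ← Finset.sum_add_distrib]
      refine Finset.sum_congr rfl fun i _ => ?_
      rw [hzlog, hz'log]
      simp only [b]
      ring)
  change mirrorStep negEntropy D m.fracStates η y g ∈ _ at hS
  change ∀ x ∈ m.fracStates, relEntropy x (mirrorStep negEntropy D m.fracStates η y g) +
    relEntropy (mirrorStep negEntropy D m.fracStates η y g) z' ≤ _ at hpyth
  refine ⟨hS, fun x hx => ?_⟩
  have h1 := hpyth x hx
  have h2 := relEntropy_nonneg (fun i => ((m.mem_fracStates_iff.1 hS.1).1 i).1) hz'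
  obtain ⟨-, hxsum⟩ := m.mem_fracStates_iff.1 hx
  obtain ⟨-, hysum⟩ := m.mem_fracStates_iff.1 hy.1
  have h3 : relEntropy x z' + η * ∑ i, g i * (x i - y i) ≤
      relEntropy x y + m.h * (η * L) ^ 2 / 2 := by
    have hshift : ∑ i, η * L * (y i - x i) = 0 := by
      rw [← Finset.mul_sum, Finset.sum_sub_distrib, hxsum, hysum, sub_self, mul_zero]
    rw [← sub_nonneg, ← hshift, ← hysum, relEntropy, relEntropy, Finset.mul_sum, Finset.sum_mul,
      Finset.sum_div, ← Finset.sum_add_distrib, ← Finset.sum_add_distrib,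
      ← Finset.sum_sub_distrib]
    refine Finset.sum_le_sum fun i _ => ?_
    have he := mul_le_mul_of_nonneg_left (exp_neg_le_quadratic (hb0 i)) (hy.2 i).le
    have hsq : y i * (b i) ^ 2 ≤ y i * (η * L) ^ 2 :=
      mul_le_mul_of_nonneg_left (pow_le_pow_left₀ (hb0 i) (hbL i) 2) (hy.2 i).le
    have hgb : η * g i = η * L - b i := by simp only [b]; ring
    rw [hz'log, ← mul_assoc, hgb]
    simp only [z']
    linarith
  linarith

/-! ### Negatively correlated roundings -/

/-- `law` is a probability law on integral states that rounds `y` with negative correlation: the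
expectation of a product of nonincreasing affine functions of the coordinates, nonnegative on
`[0, 1]`, is at most its value at `y`. All these products are allowed, and not only the products
of the coordinates of `1 - x`, because coupled rounding does not preserve a smaller class. -/
structure IsNegCorrelatedRounding {n : ℕ} (law : (Fin n → Bool) → ℝ) (y : Fin n → ℝ) : Prop where
  nonneg : ∀ s, 0 ≤ law s
  sum_eq_one : ∑ s, law s = 1
  sum_prod_le : ∀ a d : Fin n → ℝ, (∀ l, 0 ≤ d l) → (∀ l, d l ≤ a l) →
    ∑ s, law s * ∏ l, (a l - d l * bits s l) ≤ ∏ l, (a l - d l * y l)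

theorem bits_injective {n : ℕ} : Function.Injective (bits : (Fin n → Bool) → Fin n → ℝ) := by
  intro s s' h
  ext l
  have := congrFun h l
  cases h1 : s l <;> cases h2 : s' l <;> simp [bits, h1, h2] at this ⊢

open Classical in
theorem isNegCorrelatedRounding_dirac {n : ℕ} (s₀ : Fin n → Bool) :
    IsNegCorrelatedRounding (fun s => if bits s₀ = bits s then 1 else 0) (bits s₀) where
  nonneg s := by split_ifs <;> norm_num
  sum_eq_one := by simp [bits_injective.eq_iff]
  sum_prod_le a d _ _ := by simp [bits_injective.eq_iff]

theorem affine_nonneg {a d x : ℝ} (hd : 0 ≤ d) (hda : d ≤ a) (hx : x ∈ Set.Icc (0 : ℝ) 1) :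
    0 ≤ a - d * x := by
  nlinarith [hx.1, hx.2]

/-- Moving mass between two coordinates, in the two directions and without drift, can only
decrease the expected product: the linear terms cancel and the product of the two moves is
nonpositive. -/
theorem prod_shift_le {n : ℕ} {v a d : Fin n → ℝ} (hv : ∀ l, v l ∈ Set.Icc (0 : ℝ) 1)
    (hd : ∀ l, 0 ≤ d l) (hda : ∀ l, d l ≤ a l) {i j : Fin n} (hij : i ≠ j) {δ₁ δ₂ : ℝ}
    (h₁ : 0 < δ₁) (h₂ : 0 < δ₂) :
    δ₂ / (δ₁ + δ₂) * ∏ l, (a l - d l * shift v i j δ₁ l) +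
      δ₁ / (δ₁ + δ₂) * ∏ l, (a l - d l * shift v j i δ₂ l) ≤ ∏ l, (a l - d l * v l) := by
  have hsplit : ∀ f : Fin n → ℝ, ∏ l, f l = f i * (f j * ∏ l ∈ (Finset.univ.erase i).erase j, f l) :=
    fun f => by
      rw [Finset.mul_prod_erase _ _ (Finset.mem_erase.2 ⟨hij.symm, Finset.mem_univ j⟩),
        Finset.mul_prod_erase _ _ (Finset.mem_univ i)]
  have hrest : ∀ w : Fin n → ℝ, (∀ l, l ≠ i → l ≠ j → w l = v l) →
      ∏ l ∈ (Finset.univ.erase i).erase j, (a l - d l * w l) =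
        ∏ l ∈ (Finset.univ.erase i).erase j, (a l - d l * v l) := fun w hw =>
    Finset.prod_congr rfl fun l hl => by
      simp only [Finset.mem_erase] at hl
      rw [hw l hl.2.1 hl.1]
  rw [hsplit, hsplit (fun l => a l - d l * shift v j i δ₂ l), hsplit (fun l => a l - d l * v l),
    hrest _ (fun l hi hj => by simp [shift_apply v hij, hi, hj]),
    hrest (shift v j i δ₂) (fun l hi hj => by simp [shift_apply v hij.symm, hi, hj])]
  have hP : 0 ≤ ∏ l ∈ (Finset.univ.erase i).erase j, (a l - d l * v l) :=
    Finset.prod_nonneg fun l _ => affine_nonneg (hd l) (hda l) (hv l)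
  set P := ∏ l ∈ (Finset.univ.erase i).erase j, (a l - d l * v l)
  simp only [shift_apply v hij, shift_apply v hij.symm, if_neg hij, if_neg hij.symm, if_true]
  have key : (a i - d i * v i) * ((a j - d j * v j) * P) -
      (δ₂ / (δ₁ + δ₂) * ((a i - d i * (v i + δ₁)) * ((a j - d j * (v j - δ₁)) * P)) +
        δ₁ / (δ₁ + δ₂) * ((a i - d i * (v i - δ₂)) * ((a j - d j * (v j + δ₂)) * P))) =
      d i * d j * δ₁ * δ₂ * P := by
    field_simp
    ring
  have : 0 ≤ d i * d j * δ₁ * δ₂ * P :=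
    mul_nonneg (mul_nonneg (mul_nonneg (mul_nonneg (hd i) (hd j)) h₁.le) h₂.le) hP
  linarith

/-- Every iteration rounds a coordinate, so the number of fractional coordinates bounds the number of
iterations needed; integrality of the sum excludes that a single fractional coordinate remains. -/
theorem isNegCorrelatedRounding_depRoundAux {N h : ℕ} {pick : (Fin N → ℝ) → Fin N × Fin N}
    (hpick : IsPairRule pick) (n : ℕ) {v : Fin N → ℝ} (hv : ∀ l, v l ∈ Set.Icc (0 : ℝ) 1)
    (hsum : ∑ l, v l = h) (hcard : (fractional v).card ≤ n) :
    IsNegCorrelatedRounding (depRoundAux pick n v) v := by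
  induction n generalizing v with
  | zero =>
    rcases exists_eq_bits_or_unrounded hv hsum with ⟨s, rfl⟩ | ⟨i, j, hij⟩
    · exact isNegCorrelatedRounding_dirac s
    · have := Finset.card_pos.2 ⟨i, mem_fractional.2 hij.2.1⟩
      omega
  | succ n ih =>
    by_cases hex : ∃ i j, Unrounded v i j
    · have hij := hpick v hex
      set i := (pick v).1 with hi
      set j := (pick v).2 with hj
      have ih₁ := ih (shift_mem_Icc hv hij) ((sum_shift v i j _).trans hsum)
        (by have := card_fractional_shift_lt hij; omega)
      have ih₂ := ih (shift_mem_Icc hv hij.symm) ((sum_shift v j i _).trans hsum)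
        (by have := card_fractional_shift_lt hij.symm; omega)
      rw [min_comm] at ih₂
      set δ₁ := min (1 - v i) (v j)
      set δ₂ := min (v i) (1 - v j)
      have h₁ : 0 < δ₁ := lt_min (by linarith [hij.2.1.2]) hij.2.2.1
      have h₂ : 0 < δ₂ := lt_min hij.2.1.1 (by linarith [hij.2.2.2])
      have hlaw : depRoundAux pick (n + 1) v = fun s =>
          δ₂ / (δ₁ + δ₂) * depRoundAux pick n (shift v i j δ₁) s +
            δ₁ / (δ₁ + δ₂) * depRoundAux pick n (shift v j i δ₂) s := by
        ext s
        rw [depRoundAux, if_pos hij]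
      rw [hlaw]
      refine ⟨fun s => ?_, ?_, fun a d hd hda => ?_⟩
      · have := ih₁.nonneg s
        have := ih₂.nonneg s
        positivity
      · rw [Finset.sum_add_distrib, ← Finset.mul_sum, ← Finset.mul_sum, ih₁.sum_eq_one,
          ih₂.sum_eq_one]
        field_simp
        ring
      · refine le_trans ?_ (prod_shift_le hv hd hda hij.1 h₁ h₂)
        simp only [add_mul, mul_assoc]
        rw [Finset.sum_add_distrib, ← Finset.mul_sum, ← Finset.mul_sum]
        exact add_le_add (mul_le_mul_of_nonneg_left (ih₁.sum_prod_le a d hd hda) (by positivity))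
          (mul_le_mul_of_nonneg_left (ih₂.sum_prod_le a d hd hda) (by positivity))
    · rcases exists_eq_bits_or_unrounded hv hsum with ⟨s, rfl⟩ | h
      · have hlaw : depRoundAux pick (n + 1) (bits s) = depRoundAux pick 0 (bits s) := by
          ext s'
          conv_lhs => rw [depRoundAux, if_neg fun h => hex ⟨_, _, h⟩]
          rfl
        rw [hlaw]
        exact isNegCorrelatedRounding_dirac s
      · exact absurd h hex

theorem isNegCorrelatedRounding_depRound {N h : ℕ} {pick : (Fin N → ℝ) → Fin N × Fin N}
    (hpick : IsPairRule pick) {y : Fin N → ℝ} (hy : ∀ l, y l ∈ Set.Icc (0 : ℝ) 1)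
    (hsum : ∑ l, y l = h) : IsNegCorrelatedRounding (depRound pick y) y :=
  isNegCorrelatedRounding_depRoundAux hpick N hy hsum ((Finset.card_le_univ _).trans (by simp))

/-- The expectation of a product of functions of independent bits. -/
theorem sum_prod_bernoulli {n : ℕ} (p : Fin n → ℝ) (f : Fin n → ℝ → ℝ) :
    ∑ s : Fin n → Bool, (∏ i, if s i = true then p i else 1 - p i) * ∏ i, f i (bits s i) =
      ∏ i, (p i * f i 1 + (1 - p i) * f i 0) := by
  have := Fintype.prod_sum fun (i : Fin n) (b : Bool) =>
    (if b = true then p i else 1 - p i) * f i (if b = true then 1 else 0)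
  simp only [Fintype.sum_bool, if_true] at this
  simp only [← Finset.prod_mul_distrib, bits]
  simpa using this.symm

theorem sum_bernoulli {n : ℕ} (p : Fin n → ℝ) :
    ∑ s : Fin n → Bool, ∏ i, (if s i = true then p i else 1 - p i) = 1 := by
  simpa using sum_prod_bernoulli p fun _ _ => 1

theorem isNegCorrelatedRounding_coinTosses {n : ℕ} {y : Fin n → ℝ}
    (hy : ∀ l, y l ∈ Set.Icc (0 : ℝ) 1) : IsNegCorrelatedRounding (coinTosses y) y where
  nonneg s := Finset.prod_nonneg fun i _ => by
    have := (hy i).1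
    have := (hy i).2
    split_ifs <;> linarith
  sum_eq_one := sum_bernoulli y
  sum_prod_le a d _ _ := by
    have := sum_prod_bernoulli y fun i x => a i - d i * x
    simp only [coinTosses]
    rw [this]
    exact (Finset.prod_congr rfl fun i _ => by ring).le

theorem coupledOne_mem {y y' : ℝ} (hy : y ∈ Set.Icc (0 : ℝ) 1) (hy' : y' ∈ Set.Icc (0 : ℝ) 1)
    (b : Bool) : coupledOne y y' b ∈ Set.Icc (0 : ℝ) 1 := by
  obtain ⟨h0, h1⟩ := hy
  obtain ⟨h0', h1'⟩ := hy'
  rw [coupledOne]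
  split_ifs with h h h
  · rw [add_sub_cancel]
    exact ⟨div_nonneg h0' h0, div_le_one_of_le₀ (by linarith [h.2]) h0⟩
  · exact ⟨div_nonneg h.2.le (by linarith), div_le_one_of_le₀ (by linarith) (by linarith)⟩
  · simp
  · simp

theorem coupledOne_false_le_true {y y' : ℝ} (hy : y ∈ Set.Icc (0 : ℝ) 1)
    (hy' : y' ∈ Set.Icc (0 : ℝ) 1) : coupledOne y y' false ≤ coupledOne y y' true := by
  rcases lt_or_ge (y' - y) 0 with h | h
  · have : coupledOne y y' false = 0 := by
      simp [coupledOne, (sub_neg.1 h).not_gt]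
    rw [this]
    exact (coupledOne_mem hy hy' true).1
  · have : coupledOne y y' true = 1 := by simp [coupledOne, sub_nonneg.1 h]
    rw [this]
    exact (coupledOne_mem hy hy' false).2

/-- Coupled rounding keeps the marginals equal to the fractional coordinates. -/
theorem coupledOne_marginal {y y' : ℝ} (hy : y ∈ Set.Icc (0 : ℝ) 1)
    (hy' : y' ∈ Set.Icc (0 : ℝ) 1) :
    y * coupledOne y y' true + (1 - y) * coupledOne y y' false = y' := by
  obtain ⟨h0, h1⟩ := hy
  obtain ⟨h0', h1'⟩ := hy'
  rcases lt_trichotomy (y' - y) 0 with h | h | h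
  · have hy0 : y ≠ 0 := by rintro rfl; linarith
    have e1 : coupledOne y y' true = y' / y := by
      rw [coupledOne, if_pos ⟨rfl, h⟩, add_sub_cancel]
    have e2 : coupledOne y y' false = 0 := by
      simp [coupledOne, (sub_neg.1 h).not_gt]
    rw [e1, e2]
    field_simp
    ring
  · have e1 : coupledOne y y' true = 1 := by simp [coupledOne, h]
    have e2 : coupledOne y y' false = 0 := by simp [coupledOne, h]
    rw [e1, e2]
    linarith
  · have hy1 : 1 - y ≠ 0 := by intro h; linarith
    have e1 : coupledOne y y' true = 1 := by simp [coupledOne, (sub_pos.1 h).le]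
    have e2 : coupledOne y y' false = (y' - y) / (1 - y) := by
      rw [coupledOne, if_neg (by simp), if_pos ⟨rfl, h⟩]
    rw [e1, e2]
    field_simp
    ring

/-- Given the current bits, the next ones are independent with success probabilities that are
nondecreasing affine functions of the current bits; substituting these functions in a product of
nonincreasing affine functions gives a product of the same kind. -/
theorem IsNegCorrelatedRounding.coupledRound {n : ℕ} {law : (Fin n → Bool) → ℝ}
    {y y' : Fin n → ℝ} (hlaw : IsNegCorrelatedRounding law y)
    (hy : ∀ l, y l ∈ Set.Icc (0 : ℝ) 1) (hy' : ∀ l, y' l ∈ Set.Icc (0 : ℝ) 1) :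
    IsNegCorrelatedRounding (fun s' => ∑ s, law s * coupledRound y y' s s') y' where
  nonneg s' := Finset.sum_nonneg fun s _ => mul_nonneg (hlaw.nonneg s) <|
    Finset.prod_nonneg fun i _ => by
      have := (coupledOne_mem (hy i) (hy' i) (s i)).1
      have := (coupledOne_mem (hy i) (hy' i) (s i)).2
      split_ifs <;> linarith
  sum_eq_one := by
    rw [Finset.sum_comm]
    simp only [← Finset.mul_sum, SimilarityCache.coupledRound, sum_bernoulli, mul_one,
      hlaw.sum_eq_one]
  sum_prod_le a d hd hda := by
    let p (b : Bool) (l : Fin n) : ℝ := coupledOne (y l) (y' l) b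
    have h1 := hlaw.sum_prod_le (fun l => a l - d l * p false l)
      (fun l => d l * (p true l - p false l))
      (fun l => mul_nonneg (hd l) (sub_nonneg.2 (coupledOne_false_le_true (hy l) (hy' l))))
      (fun l => by
        have := mul_le_mul_of_nonneg_left (coupledOne_mem (hy l) (hy' l) true).2 (hd l)
        have := hda l
        simp only [p]
        linarith)
    have h2 : ∏ l, (a l - d l * p false l - d l * (p true l - p false l) * y l) =
        ∏ l, (a l - d l * y' l) := Finset.prod_congr rfl fun l _ => by
      rw [← coupledOne_marginal (hy l) (hy' l)]
      simp only [p]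
      ring
    rw [h2] at h1
    refine le_trans (le_of_eq ?_) h1
    simp only [Finset.sum_mul]
    rw [Finset.sum_comm]
    refine Finset.sum_congr rfl fun s _ => ?_
    simp only [mul_assoc, ← Finset.mul_sum]
    congr 1
    have h3 := sum_prod_bernoulli (fun l => p (s l) l) fun l x => a l - d l * x
    simp only [SimilarityCache.coupledRound]
    rw [h3]
    refine Finset.prod_congr rfl fun l _ => ?_
    cases h : s l <;> simp [bits, h] <;> ring

/-! ### The loss of a factor `1 - 1 / e` -/

theorem one_sub_sum_le_prod_one_sub {ι : Type*} (A : Finset ι) (u : ι → ℝ)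
    (h0 : ∀ i ∈ A, 0 ≤ u i) (h1 : ∀ i ∈ A, u i ≤ 1) :
    1 - ∑ i ∈ A, u i ≤ ∏ i ∈ A, (1 - u i) := by
  classical
  induction A using Finset.induction_on with
  | empty => simp
  | insert i A hi ih =>
    rw [Finset.sum_insert hi, Finset.prod_insert hi]
    have ih := ih (fun j hj => h0 j (Finset.mem_insert_of_mem hj))
      (fun j hj => h1 j (Finset.mem_insert_of_mem hj))
    have hS : 0 ≤ ∑ j ∈ A, u j :=
      Finset.sum_nonneg fun j hj => h0 j (Finset.mem_insert_of_mem hj)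
    have hi0 := h0 i (Finset.mem_insert_self _ _)
    have hi1 := h1 i (Finset.mem_insert_self _ _)
    nlinarith [mul_le_mul_of_nonneg_left ih (sub_nonneg.2 hi1)]

/-- By convexity `exp (-t)` lies below its chord on `[0, 1]`. -/
theorem mul_min_one_le_one_sub_exp_neg {t : ℝ} (ht : 0 ≤ t) :
    (1 - 1 / Real.exp 1) * min 1 t ≤ 1 - Real.exp (-t) := by
  set u := min 1 t
  have hu0 : 0 ≤ u := le_min zero_le_one ht
  have hu1 : u ≤ 1 := min_le_left _ _
  have h1 : Real.exp (-t) ≤ Real.exp (-u) := Real.exp_le_exp.2 (by linarith [min_le_right 1 t])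
  have h2 := convexOn_exp.2 (Set.mem_univ (0 : ℝ)) (Set.mem_univ (-1 : ℝ))
    (sub_nonneg.2 hu1) hu0 (by ring)
  simp only [smul_eq_mul, mul_zero, zero_add, mul_neg, mul_one, Real.exp_zero] at h2
  rw [one_div, ← Real.exp_neg]
  linarith

/-- The product `c (1 - ∏ (1 - xₗ / c))` lies below `min c (∑ xₗ)` at every point, and within a
factor `1 - 1 / e` of it; unlike the minimum, it can be compared across the rounding. -/
theorem IsNegCorrelatedRounding.min_le {n : ℕ} {law : (Fin n → Bool) → ℝ} {y : Fin n → ℝ}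
    (hlaw : IsNegCorrelatedRounding law y) (hy : ∀ l, y l ∈ Set.Icc (0 : ℝ) 1)
    (A : Finset (Fin n)) {c : ℝ} (hc : 1 ≤ c) :
    (1 - 1 / Real.exp 1) * min c (∑ l ∈ A, y l) ≤
      ∑ s, law s * min c (∑ l ∈ A, bits s l) := by
  classical
  have hc0 : 0 < c := by linarith
  let d : Fin n → ℝ := fun l => if l ∈ A then 1 / c else 0
  have hd0 : ∀ l, 0 ≤ d l := fun l => by simp only [d]; split_ifs <;> positivity
  have hd1 : ∀ l, d l ≤ 1 := fun l => by
    simp only [d]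
    split_ifs
    · exact (div_le_one hc0).2 hc
    · exact zero_le_one
  have hdsum : ∀ x : Fin n → ℝ, ∑ l, d l * x l = (∑ l ∈ A, x l) / c := fun x => by
    simp only [d, ite_mul, zero_mul, Finset.sum_ite_mem, Finset.univ_inter, ← Finset.mul_sum]
    ring
  have hbelow : ∀ s, c * (1 - ∏ l, (1 - d l * bits s l)) ≤ min c (∑ l ∈ A, bits s l) := by
    intro s
    have hb : ∀ l, bits s l ∈ Set.Icc (0 : ℝ) 1 := fun l => by
      rcases bits_mem_zero_one s l with h | h <;> simp [h]
    have h1 := one_sub_sum_le_prod_one_sub Finset.univ (fun l => d l * bits s l)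
      (fun l _ => mul_nonneg (hd0 l) (hb l).1)
      (fun l _ => mul_le_one₀ (hd1 l) (hb l).1 (hb l).2)
    have h2 : 0 ≤ ∏ l, (1 - d l * bits s l) :=
      Finset.prod_nonneg fun l _ => affine_nonneg (hd0 l) (hd1 l) (hb l)
    rw [hdsum, sub_le_iff_le_add, ← sub_le_iff_le_add', le_div_iff₀ hc0] at h1
    refine le_min ?_ ?_
    · nlinarith
    · linarith
  have habove : ∏ l, (1 - d l * y l) ≤ Real.exp (-((∑ l ∈ A, y l) / c)) := by
    rw [← hdsum, ← Finset.sum_neg_distrib, Real.exp_sum]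
    exact Finset.prod_le_prod (fun l _ => affine_nonneg (hd0 l) (hd1 l) (hy l))
      fun l _ => Real.one_sub_le_exp_neg _
  have hexp := mul_min_one_le_one_sub_exp_neg
    (div_nonneg (Finset.sum_nonneg fun l (_ : l ∈ A) => (hy l).1) hc0.le)
  have hmin : min c (∑ l ∈ A, y l) = c * min 1 ((∑ l ∈ A, y l) / c) := by
    rw [mul_min_of_nonneg _ _ hc0.le, mul_one, mul_div_cancel₀ _ hc0.ne']
  calc (1 - 1 / Real.exp 1) * min c (∑ l ∈ A, y l)
      = c * ((1 - 1 / Real.exp 1) * min 1 ((∑ l ∈ A, y l) / c)) := by rw [hmin]; ring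
    _ ≤ c * (1 - ∏ l, (1 - d l * y l)) := mul_le_mul_of_nonneg_left (by linarith) hc0.le
    _ ≤ c * (1 - ∑ s, law s * ∏ l, (1 - d l * bits s l)) :=
        mul_le_mul_of_nonneg_left (by linarith [hlaw.sum_prod_le (fun _ => 1) d hd0 hd1]) hc0.le
    _ = ∑ s, law s * (c * (1 - ∏ l, (1 - d l * bits s l))) := by
        have h : ∀ s, law s * (c * (1 - ∏ l, (1 - d l * bits s l))) =
            c * (law s - law s * ∏ l, (1 - d l * bits s l)) := fun s => by ring
        simp only [h]
        rw [← Finset.mul_sum, Finset.sum_sub_distrib, hlaw.sum_eq_one]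
    _ ≤ ∑ s, law s * min c (∑ l ∈ A, bits s l) :=
        Finset.sum_le_sum fun s _ => mul_le_mul_of_nonneg_left (hbelow s) (hlaw.nonneg s)

/-- In expectation, rounding keeps a fraction `1 - 1 / e` of the fractional gain. -/
theorem IsNegCorrelatedRounding.gain_le (r : R)
    {law : (Fin m.N → Bool) → ℝ} {y : Fin m.N → ℝ} (hlaw : IsNegCorrelatedRounding law y)
    (hy : ∀ l, y l ∈ Set.Icc (0 : ℝ) 1) :
    (1 - 1 / Real.exp 1) * m.fracGain r y ≤ ∑ s, law s * m.gain r (augment (bits s)) := by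
  simp only [gain_augment_bits, fracGain_eq, Finset.mul_sum]
  rw [Finset.sum_comm]
  refine Finset.sum_le_sum fun i hi => ?_
  have hc : (1 : ℝ) ≤ m.k - m.sigma r i := by
    have : m.sigma r i + 1 ≤ m.k := (m.bigK_spec r).2.2 i (Finset.mem_Ico.1 hi).2
    have : (m.sigma r i : ℝ) + 1 ≤ m.k := by exact_mod_cast this
    linarith
  have := mul_le_mul_of_nonneg_left (hlaw.min_le hy (m.active r i) hc) (m.alpha_nonneg r hi)
  simp only [mul_left_comm _ (m.alpha r i), ← Finset.mul_sum]
  exact this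

/-! ### Trajectories of integral states -/

/-- The law of the integral state at time `t`. -/
noncomputable def stateLaw {N : ℕ} (pick : (Fin N → ℝ) → Fin N × Fin N) (scheme : RoundingScheme)
    (y : ℕ → Fin N → ℝ) : ℕ → (Fin N → Bool) → ℝ
  | 0 => initLaw pick scheme (y 0)
  | t + 1 => fun s' => ∑ s, stateLaw pick scheme y t s *
      stepLaw pick scheme (t + 1) (y t) (y (t + 1)) s s'

variable {N : ℕ} {pick : (Fin N → ℝ) → Fin N × Fin N} {scheme : RoundingScheme}
  {y : ℕ → Fin N → ℝ}

theorem trajLaw_snoc (T : ℕ) (w : Fin (T + 1) → Fin N → Bool) (s : Fin N → Bool) :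
    trajLaw pick scheme y (T + 2) (Fin.snoc (α := fun _ => Fin N → Bool) w s) =
      trajLaw pick scheme y (T + 1) w *
        stepLaw pick scheme (T + 1) (y T) (y (T + 1)) (w (Fin.last T)) s := by
  have hw : ∀ (u : ℕ) (hu : u < T + 1),
      (Fin.snoc (α := fun _ => Fin N → Bool) w s : Fin (T + 2) → Fin N → Bool)
        ⟨u, Nat.lt_succ_of_lt hu⟩ = w ⟨u, hu⟩ :=
    fun u hu => Fin.snoc_castSucc (α := fun _ => Fin N → Bool) s w ⟨u, hu⟩
  have hs : (Fin.snoc (α := fun _ => Fin N → Bool) w s : Fin (T + 2) → Fin N → Bool)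
      ⟨T + 1, Nat.lt_succ_self _⟩ = s := Fin.snoc_last (α := fun _ => Fin N → Bool) s w
  rw [trajLaw, Fin.prod_univ_castSucc, trajLaw]
  congr 1
  · refine Finset.prod_congr rfl fun t _ => ?_
    obtain ⟨_ | u, ht⟩ := t
    · exact congrArg (initLaw pick scheme (y 0)) (hw 0 ht)
    · exact congrArg₂ (stepLaw pick scheme (u + 1) (y u) (y (u + 1))) (hw u (Nat.lt_of_succ_lt ht))
        (hw (u + 1) ht)
  · exact congrArg₂ (stepLaw pick scheme (T + 1) (y T) (y (T + 1)))
      (hw T (Nat.lt_succ_self T)) hs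

theorem sum_snoc {α : Type*} [Fintype α] (T : ℕ) (F : (Fin (T + 1) → α) → ℝ) :
    ∑ w, F w = ∑ w : Fin T → α, ∑ s, F (Fin.snoc (α := fun _ => α) w s) := by
  rw [← (Fin.snocEquiv fun _ : Fin (T + 1) => α).sum_comp, Fintype.sum_prod_type, Finset.sum_comm]
  rfl

theorem sum_trajLaw_last (T : ℕ) (φ : (Fin N → Bool) → ℝ) :
    ∑ w, trajLaw pick scheme y (T + 1) w * φ (w (Fin.last T)) =
      ∑ s, stateLaw pick scheme y T s * φ s := by
  induction T generalizing φ with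
  | zero =>
    rw [← (Equiv.funUnique (Fin 1) (Fin N → Bool)).symm.sum_comp]
    refine Finset.sum_congr rfl fun s _ => ?_
    simp [trajLaw, stateLaw]
  | succ T ih =>
    have h := ih fun s => ∑ s', stepLaw pick scheme (T + 1) (y T) (y (T + 1)) s s' * φ s'
    rw [sum_snoc]
    simp only [trajLaw_snoc, Fin.snoc_last, mul_assoc, ← Finset.mul_sum]
    rw [h]
    simp only [stateLaw, Finset.sum_mul, Finset.mul_sum]
    rw [Finset.sum_comm]
    simp only [mul_assoc]

theorem sum_trajLaw_sum
    (hstep : ∀ t s, ∑ s', stepLaw pick scheme (t + 1) (y t) (y (t + 1)) s s' = 1)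
    (φ : ℕ → (Fin N → Bool) → ℝ) (T : ℕ) :
    ∑ w : Fin (T + 1) → Fin N → Bool,
      trajLaw pick scheme y (T + 1) w * ∑ t : Fin (T + 1), φ t (w t) =
      ∑ t ∈ Finset.range (T + 1), ∑ s, stateLaw pick scheme y t s * φ t s := by
  induction T with
  | zero =>
    rw [Finset.sum_range_one, ← sum_trajLaw_last]
    simp
  | succ T ih =>
    rw [Finset.sum_range_succ, ← ih, ← sum_trajLaw_last]
    simp only [Fin.sum_univ_castSucc (n := T + 1), mul_add, Finset.sum_add_distrib]
    congr 1
    rw [sum_snoc]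
    simp only [trajLaw_snoc, Fin.snoc_castSucc, mul_right_comm _ (stepLaw _ _ _ _ _ _ _)]
    simp only [← Finset.mul_sum, hstep, mul_one, Fin.val_castSucc]

theorem sum_stepLaw (hpick : IsPairRule pick)
    (hscheme : scheme = .depRound 1 ∨ ∃ init, scheme = .coupled init)
    {h : ℕ} (hy : ∀ t l, y t l ∈ Set.Icc (0 : ℝ) 1) (hsum : ∀ t, ∑ l, y t l = h)
    (t : ℕ) (s : Fin N → Bool) :
    ∑ s', stepLaw pick scheme (t + 1) (y t) (y (t + 1)) s s' = 1 := by
  rcases hscheme with rfl | ⟨init, rfl⟩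
  · simpa [stepLaw] using (isNegCorrelatedRounding_depRound hpick (hy (t + 1)) (hsum _)).sum_eq_one
  · exact sum_bernoulli _

theorem isNegCorrelatedRounding_stateLaw (hpick : IsPairRule pick)
    (hscheme : scheme = .depRound 1 ∨ ∃ init, scheme = .coupled init)
    {h : ℕ} (hy : ∀ t l, y t l ∈ Set.Icc (0 : ℝ) 1) (hsum : ∀ t, ∑ l, y t l = h) (t : ℕ) :
    IsNegCorrelatedRounding (stateLaw pick scheme y t) (y t) := by
  have hdep : ∀ t, IsNegCorrelatedRounding (depRound pick (y t)) (y t) := fun t =>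
    isNegCorrelatedRounding_depRound hpick (hy t) (hsum t)
  induction t with
  | zero =>
    rcases hscheme with rfl | ⟨_ | _, rfl⟩
    · exact hdep 0
    · exact hdep 0
    · exact isNegCorrelatedRounding_coinTosses (hy 0)
  | succ t ih =>
    rcases hscheme with rfl | ⟨init, rfl⟩
    · have : stateLaw pick (.depRound 1) y (t + 1) = depRound pick (y (t + 1)) := by
        ext s'
        simp [stateLaw, stepLaw, ← Finset.sum_mul, ih.sum_eq_one]
      rw [this]
      exact hdep (t + 1)
    · exact ih.coupledRound (hy t) (hy (t + 1))

/-! ### Regret -/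

theorem le_expectedGain {pick : (Fin m.N → ℝ) → Fin m.N × Fin m.N} (hpick : IsPairRule pick)
    (hscheme : scheme = .depRound 1 ∨ ∃ init, scheme = .coupled init) {y : ℕ → Fin m.N → ℝ}
    (hy : ∀ t, y t ∈ m.fracStates) {T : ℕ} (hT : 1 ≤ T) (r : ℕ → R) :
    (1 - 1 / Real.exp 1) * ∑ t ∈ Finset.range T, m.fracGain (r t) (y t) ≤
      m.expectedGain pick scheme y T r := by
  have hy01 := fun t => (m.mem_fracStates_iff.1 (hy t)).1
  have hysum := fun t => (m.mem_fracStates_iff.1 (hy t)).2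
  obtain ⟨T, rfl⟩ := Nat.exists_eq_add_of_le' hT
  rw [expectedGain, sum_trajLaw_sum (sum_stepLaw hpick hscheme hy01 hysum)
    (fun t s => m.gain (r t) (augment (bits s))), Finset.mul_sum]
  exact Finset.sum_le_sum fun t _ => (isNegCorrelatedRounding_stateLaw hpick hscheme hy01 hysum
    t).gain_le m (r t) (hy01 t)

variable {sub : R → (Fin m.N → ℝ) → Fin m.N → ℝ} {L : ℝ}

theorem oma_mem (hsub : ∀ r, ∀ y ∈ m.fracStates ∩ posOrthant m.N, m.IsSubgradient r y (sub r y))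
    (hL : ∀ r, m.kthDissimilarity r + m.cf ≤ L) {η : ℝ} (hη : 0 ≤ η) (r : ℕ → R) (t : ℕ) :
    m.oma negEntropy (posOrthant m.N) η sub r t ∈ m.fracStates ∩ posOrthant m.N := by
  induction t with
  | zero => exact m.initial_state_spec.1
  | succ t ih =>
    have hg := hsub (r t) _ ih
    exact (m.mirrorStep_spec hη ih hg.nonneg fun i => (hg.le i).trans (hL _)).1

/-- The standard potential argument, with the relative entropy to the comparator as potential. -/
theorem oma_regret_mul_le
    (hsub : ∀ r, ∀ y ∈ m.fracStates ∩ posOrthant m.N, m.IsSubgradient r y (sub r y))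
    (hL : ∀ r, m.kthDissimilarity r + m.cf ≤ L) {η : ℝ} (hη : 0 ≤ η) (r : ℕ → R)
    {x : Fin m.N → ℝ} (hx : x ∈ m.fracStates) (T : ℕ) :
    η * ∑ t ∈ Finset.range T, (m.fracGain (r t) x -
      m.fracGain (r t) (m.oma negEntropy (posOrthant m.N) η sub r t)) ≤
      m.h * Real.log ((m.N : ℝ) / m.h) + T * (m.h * (η * L) ^ 2 / 2) := by
  have hmem := m.oma_mem hsub hL hη r
  set y := m.oma negEntropy (posOrthant m.N) η sub r with hydef
  have hpot : ∀ T : ℕ, η * ∑ t ∈ Finset.range T, (m.fracGain (r t) x - m.fracGain (r t) (y t)) +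
      relEntropy x (y T) ≤ relEntropy x (y 0) + T * (m.h * (η * L) ^ 2 / 2) := by
    intro T
    induction T with
    | zero => simp
    | succ T ih =>
      have hg := hsub (r T) _ (hmem T)
      have h1 := (m.mirrorStep_spec hη (hmem T) hg.nonneg
        fun i => (hg.le i).trans (hL _)).2 x hx
      change _ ≤ relEntropy x (y T) - relEntropy x (y (T + 1)) + _ at h1
      have h2 := mul_le_mul_of_nonneg_left (hg x) hη
      rw [Finset.sum_range_succ]
      push_cast
      linarith
  have h0 : relEntropy x (y 0) ≤ m.h * Real.log ((m.N : ℝ) / m.h) := m.initial_state_spec.2 x hx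
  have h1 := relEntropy_nonneg (fun i => ((m.mem_fracStates_iff.1 hx).1 i).1) (hmem T).2
  linarith [hpot T]

/-- A full cache has a single fractional state. -/
theorem eq_of_mem_fracStates_of_h_eq_N (hN : m.h = m.N) {x : Fin m.N → ℝ}
    (hx : x ∈ m.fracStates) : x = fun _ => 1 := by
  obtain ⟨h01, hsum⟩ := m.mem_fracStates_iff.1 hx
  have h0 : ∑ i, (1 - x i) = 0 := by simp [Finset.sum_sub_distrib, hsum, hN]
  rw [Finset.sum_eq_zero_iff_of_nonneg fun i _ => sub_nonneg.2 (h01 i).2] at h0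
  ext i
  linarith [h0 i (Finset.mem_univ i)]

theorem log_div_nonneg : 0 ≤ Real.log ((m.N : ℝ) / m.h) := by
  have hh : (0 : ℝ) < m.h := by exact_mod_cast m.one_le_h
  refine Real.log_nonneg ((one_le_div hh).2 ?_)
  exact_mod_cast m.h_le_N

/-- The learning rate balances the two terms of the potential bound. -/
theorem oma_regret_le {cdk : ℝ}
    (hsub : ∀ r, ∀ y ∈ m.fracStates ∩ posOrthant m.N, m.IsSubgradient r y (sub r y))
    (hcdk : ∀ r, m.kthDissimilarity r ≤ cdk) {T : ℕ} (hT : 1 ≤ T) (r : ℕ → R)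
    {x : Fin m.N → ℝ} (hx : x ∈ m.fracStates) :
    ∑ t ∈ Finset.range T, m.fracGain (r t) x -
      ∑ t ∈ Finset.range T, m.fracGain (r t)
        (m.oma negEntropy (posOrthant m.N) (m.learningRate cdk T) sub r t) ≤
      (cdk + m.cf) * m.h * √(2 * Real.log ((m.N : ℝ) / m.h) * T) := by
  have hL : 0 < cdk + m.cf :=
    add_pos_of_nonneg_of_pos ((m.kthDissimilarity_nonneg (r 0)).trans (hcdk _)) m.cf_pos
  have hLr : ∀ r, m.kthDissimilarity r + m.cf ≤ cdk + m.cf := fun r => by linarith [hcdk r]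
  have hη : 0 ≤ m.learningRate cdk T := by unfold learningRate; positivity
  have hT0 : (0 : ℝ) < T := by exact_mod_cast hT
  have hlog := m.log_div_nonneg
  rw [← Finset.sum_sub_distrib]
  -- If `h = N` the learning rate is `0` and the potential bound says nothing.
  rcases m.h_le_N.eq_or_lt with hN | hN
  · have hmem := m.oma_mem hsub hLr hη r
    rw [Finset.sum_eq_zero fun t _ => by
      rw [m.eq_of_mem_fracStates_of_h_eq_N hN hx, m.eq_of_mem_fracStates_of_h_eq_N hN (hmem t).1,
        sub_self]]
    positivity
  · have hh : (0 : ℝ) < m.h := by exact_mod_cast m.one_le_h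
    have hlog' : 0 < Real.log ((m.N : ℝ) / m.h) :=
      Real.log_pos ((one_lt_div hh).2 (by exact_mod_cast hN))
    have h := m.oma_regret_mul_le hsub hLr hη r hx T
    set η := m.learningRate cdk T with hηdef
    set ℓ := Real.log ((m.N : ℝ) / m.h)
    have hηL : η * (cdk + m.cf) = √(2 * ℓ / T) := by
      rw [hηdef, learningRate]
      field_simp
      rfl
    have hη0 : 0 < η := by rw [hηdef, learningRate]; positivity
    have hsq : (η * (cdk + m.cf)) ^ 2 = 2 * ℓ / T := by
      rw [hηL, Real.sq_sqrt (by positivity)]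
    have hprod : η * (cdk + m.cf) * √(2 * ℓ * T) = 2 * ℓ := by
      rw [hηL, ← Real.sqrt_mul (by positivity), show 2 * ℓ / T * (2 * ℓ * T) = (2 * ℓ) ^ 2 by
        field_simp, Real.sqrt_sq (by positivity)]
    refine le_of_mul_le_mul_left (h.trans (le_of_eq ?_)) hη0
    rw [hsq, show η * ((cdk + m.cf) * m.h * √(2 * ℓ * T)) =
      m.h * (η * (cdk + m.cf) * √(2 * ℓ * T)) by ring, hprod]
    field_simp
    ring

theorem nonempty_states : m.states.Nonempty := by
  by_contra hc
  have h := m.initial_state_spec.1.1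
  rw [fracStates, Set.not_nonempty_iff_eq_empty.1 hc, convexHull_empty] at h
  exact h

theorem regret_le {cdk : ℝ}
    (hsub : ∀ r, ∀ y ∈ m.fracStates ∩ posOrthant m.N, m.IsSubgradient r y (sub r y))
    (hcdk : ∀ r, m.kthDissimilarity r ≤ cdk)
    {pick : (Fin m.N → ℝ) → Fin m.N × Fin m.N} (hpick : IsPairRule pick)
    (hscheme : scheme = .depRound 1 ∨ ∃ init, scheme = .coupled init) {T : ℕ} (hT : 1 ≤ T) :
    m.regret (1 - 1 / Real.exp 1) negEntropy (posOrthant m.N) (m.learningRate cdk T) sub pick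
      scheme T ≤ (((1 - 1 / Real.exp 1) * (cdk + m.cf) * m.h *
          √(2 * Real.log ((m.N : ℝ) / m.h) * T) : ℝ) : EReal) := by
  refine iSup_le fun r => EReal.coe_le_coe_iff.2 ?_
  have hL : 0 < cdk + m.cf :=
    add_pos_of_nonneg_of_pos ((m.kthDissimilarity_nonneg (r 0)).trans (hcdk _)) m.cf_pos
  have hη : 0 ≤ m.learningRate cdk T := by unfold learningRate; positivity
  have hmem := m.oma_mem hsub (L := cdk + m.cf) (fun r => by linarith [hcdk r]) hη r
  have hexp := m.le_expectedGain hpick hscheme (fun t => (hmem t).1) hT r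
  have hψ : 0 ≤ 1 - 1 / Real.exp 1 := by
    rw [sub_nonneg, div_le_one (Real.exp_pos 1)]
    exact Real.one_le_exp zero_le_one
  have : Nonempty m.states := m.nonempty_states.to_subtype
  have hbest : m.bestStaticGain T r ≤ ∑ t ∈ Finset.range T, m.fracGain (r t)
        (m.oma negEntropy (posOrthant m.N) (m.learningRate cdk T) sub r t) +
      (cdk + m.cf) * m.h * √(2 * Real.log ((m.N : ℝ) / m.h) * T) := by
    refine ciSup_le fun x => ?_
    obtain ⟨s, hs⟩ := m.exists_eq_augment_bits x.2
    have hfrac : bits s ∈ m.fracStates := subset_convexHull ℝ _ (hs ▸ x.2)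
    have h := m.oma_regret_le hsub hcdk hT r hfrac
    rw [hs, Fin.sum_univ_eq_sum_range (fun t => m.gain (r t) (augment (bits s)))]
    simp only [gain_augment_bits]
    linarith
  have := mul_le_mul_of_nonneg_left hbest hψ
  linarith

end SimilarityCache

theorem theorem3 {R : Type*} (m : SimilarityCache R)
    (cdk : ℝ) (hcdk : ∀ r, m.kthDissimilarity r ≤ cdk)
    (sub : R → (Fin m.N → ℝ) → Fin m.N → ℝ)
    (hsub : ∀ r, ∀ y ∈ m.fracStates ∩ SimilarityCache.posOrthant m.N,
      sub r y = m.explicitSubgradient r y ∨ m.IsSubgradient r y (sub r y))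
    (pick : (Fin m.N → ℝ) → Fin m.N × Fin m.N) (hpick : SimilarityCache.IsPairRule pick)
    (scheme : SimilarityCache.RoundingScheme)
    (hscheme : scheme = .depRound 1 ∨ ∃ init, scheme = .coupled init) :
    (∀ T : ℕ, 1 ≤ T →
      m.regret (1 - 1 / Real.exp 1) SimilarityCache.negEntropy (SimilarityCache.posOrthant m.N)
          (m.learningRate cdk T) sub pick scheme T ≤
        (((1 - 1 / Real.exp 1) * (cdk + m.cf) * m.h *
          √(2 * Real.log ((m.N : ℝ) / m.h) * T) : ℝ) : EReal)) ∧
    (∀ ε : ℝ, 0 < ε → ∀ᶠ T : ℕ in Filter.atTop,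
      m.regret (1 - 1 / Real.exp 1) SimilarityCache.negEntropy (SimilarityCache.posOrthant m.N)
          (m.learningRate cdk T) sub pick scheme T ≤ ((ε * T : ℝ) : EReal)) := by
  have hsub' : ∀ r, ∀ y ∈ m.fracStates ∩ SimilarityCache.posOrthant m.N,
      m.IsSubgradient r y (sub r y) := by
    intro r y hy
    rcases hsub r y hy with h | h
    · rw [h]
      exact m.isSubgradient_explicitSubgradient r (m.mem_fracStates_iff.1 hy.1).1
    · exact h
  have hmain := fun (T : ℕ) (hT : 1 ≤ T) => m.regret_le hsub' hcdk hpick hscheme hT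
  refine ⟨hmain, fun ε hε => ?_⟩
  set C := (1 - 1 / Real.exp 1) * (cdk + m.cf) * m.h * √(2 * Real.log ((m.N : ℝ) / m.h)) with hC
  filter_upwards [(Real.tendsto_sqrt_atTop.comp tendsto_natCast_atTop_atTop).eventually_ge_atTop
    (C / ε), Filter.eventually_ge_atTop 1] with T hT hT1
  refine (hmain T hT1).trans (EReal.coe_le_coe_iff.2 ?_)
  have hlog := m.log_div_nonneg
  rw [Real.sqrt_mul (by positivity), ← mul_assoc, ← hC]
  have h1 : C ≤ ε * √T := by
    rw [← div_le_iff₀' hε]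
    exact hT
  calc C * √T ≤ ε * √T * √T := mul_le_mul_of_nonneg_right h1 (Real.sqrt_nonneg _)
    _ = ε * T := by rw [mul_assoc, Real.mul_self_sqrt (Nat.cast_nonneg T)]
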